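/- Let $\mathbb K$ be a field, $R=\mathbb K[x_0,\dots,x_n]$ with $x_0<\dots<x_n$, $R_A=A[x_0,\dots,x_n]$ for a $\mathbb K$-algebra $A$, and $R_A^m(-\boldsymbol d)=\bigoplus_{k=1}^m R_A(-d_k)\,e_k$. A term is an element $x^\alpha e_k$. The multiplicative variables of $x^\alpha$ are those $\le\min(x^\alpha)$, the smallest variable dividing $x^\alpha$ (all variables if $x^\alpha=1$). The Pommaret cone of $x^\alpha e_k$ is the set of the terms $x^\delta x^\alpha e_k$ with $x^\delta$ a product of multiplicative variables of $x^\alpha$. Let $U\subseteq R^m(-\boldsymbol d)$ be quasi-stable, i.e. a monomial submodule with a finite Pommaret basis $\mathcal P_U$: a finite set of terms generating $U$ such that the set of terms in $U$ is the disjoint union of the cones of the elements of $\mathcal P_U$. Let $\mathcal N(U)$ be the set of terms not in $U$, and let $D=\min\{i : x_i=\min(x^\alpha),\ x^\alpha e_k\in\mathcal P_U,\ x^\alpha\ne1\}$ ($D=n$ if there is no such term). Put $U^{(0)}=U$. For $t\ge 0$ let $U^{(t+1)}$ be the monomial submodule of the free module with basis $f_\tau$, $\tau\in\mathcal P_{U^{(t)}}$,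 $\deg f_\tau=\deg\tau$, whose Pommaret basis is $\{x_if_\tau : x_i \text{ non-multiplicative for the monomial of }\tau\}$. A $U$-marked set over $A$ is a family of homogeneous elements $F_\tau$, $\tau\in\mathcal P_U$, with $F_\tau-\tau\in\langle\mathcal N(U)\rangle_A$ and $\deg F_\tau=\deg\tau$; it is a $U$-marked basis if $(R_A^m(-\boldsymbol d))_s=(F)_s\oplus\langle\mathcal N(U)_s\rangle$ for all $s$. The normal form of $f$ is the element $g\in\langle\mathcal N(U)\rangle$ in the unique writing $f=\sum_\gamma P_\gamma F_\gamma+g$ with $P_\gamma$ involving only multiplicative variables of (the monomial of) $\gamma$. If $F$ is a marked basis, its fundamental syzygies are the $x_if_\tau-\sum_\gamma P_\gamma f_\gamma$, where $x_i$ is non-multiplicative for $\tau$ and $x_iF_\tau=\sum_\gamma P_\gamma F_\gamma$ is this writing. The same definitions apply to every $U^{(t)}$. The $U$-marked resolution functor sends a Noetherian $\mathbb K$-algebra $A$ to the set of tuples $(M,S_1,\dots,S_{n-D})$ where $M\subseteq R_A^m(-\boldsymbol d)$ is a graded submodule with $M\oplus\langle\mathcal N(U)\rangle=R_A^m(-\boldsymbol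 d)$ and $S_t$ is the syzygy module of $F^{\partial_{t-1}}$ for $1\le t\le n-D$; here $F^{\partial_0}$ is the $U$-marked basis generating $M$ and $F^{\partial_{t}}$ is the set of fundamental syzygies of $F^{\partial_{t-1}}$. On morphisms it is extension of scalars. Let $C$ be the set of parameters $C_\tau^\sigma$, $\tau\in\mathcal P_U$, $\sigma\in\mathcal N(U)$, $\deg\sigma=\deg\tau$, and let $M_0$ be the matrix with columns $F_\tau=\tau-\sum_\sigma C_\tau^\sigma\sigma$. For $t\ge1$ let $B^{(t)}$ be the set of parameters $B_\rho^\sigma$, where $\rho=x_if_\tau\in\mathcal P_{U^{(t)}}$ and $\sigma=x^\eta f_\gamma\in\mathcal N(U^{(t)})$ has the same degree as $\rho$, with all variables of $x^\eta$ smaller than $x_i$ and multiplicative for the monomial of $\gamma\in\mathcal P_{U^{(t-1)}}$, and let $M_t$ be the matrix with columns $\rho-\sum_\sigma B_\rho^\sigma\sigma$. Let $\mathscr S^{(t)}$ be the ideal of $\mathbb K[C,B^{(1)},\dots,B^{(n-D)}]$ generated by the coefficients of the terms $x^\eta$ in the entries of $M_{t-1}M_t$. Let $\mathscr U\subseteq\mathbb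 K[C]$ be the ideal generated by the coefficients of the normal forms of all $x_iF_\tau$, $\tau\in\mathcal P_U$, $x_i$ non-multiplicative for $\tau$, with respect to the generic marked set $(F_\tau)$; $\mathbf{Mf}_U=\mathrm{Spec}(\mathbb K[C]/\mathscr U)$. Then: 1. The $U$-marked resolution functor is well defined on morphisms and is represented by $$\mathbf{MRes}_U=\mathrm{Spec}\bigl(\mathbb K[C,B^{(1)},\dots,B^{(n-D)}]/(\mathscr S^{(1)}+\dots+\mathscr S^{(n-D)})\bigr),$$ a $\mathbb K$-algebra homomorphism $\varphi$ from its coordinate ring to $A$ corresponding to the tuple of the modules generated by the columns of $\varphi(M_0),\varphi(M_1),\dots,\varphi(M_{n-D})$. 2. The parameters can be eliminated recursively: for $1\le t\le n-D$, every parameter in $B^{(t)}$ is congruent modulo $\mathscr S^{(t)}$ to a polynomial in $\mathbb K[B^{(t-1)}]$ (in $\mathbb K[C]$ if $t=1$). 3. $\mathscr U=(\mathscr S^{(1)}+\dots+\mathscr S^{(n-D)})\cap\mathbb K[C]$, and the inclusion $\mathbb K[C]\subseteq\mathbb K[C,B^{(1)},\dots,B^{(n-D)}]$ induces an isomorphism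 of schemes $\mathbf{MRes}_U\simeq\mathbf{Mf}_U$. -/

import Mathlib

open CategoryTheory

universe u

namespace MarkedRes

noncomputable section

/-- Exponents of terms `x^α` in the variables `x_0 < x_1 < ⋯ < x_n`. -/
abbrev Mon (n : ℕ) : Type := Fin (n + 1) →₀ ℕ

/-- The (index of the) smallest variable dividing `x^α`. For `x^α = 1` the value is the largest
variable `x_n`, so that in every case the multiplicative variables of `x^α` are exactly the `x_j`
with `j ≤ minVar α` (all the variables when `x^α = 1`). -/
def minVar {n : ℕ} (α : Mon n) : Fin (n + 1) := α.support.inf id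

/-- The term `x^σ.2 e_σ.1` of the free module with coordinates in `ι`. -/
def term {n : ℕ} (S : Type*) [CommRing S] {ι : Type} (σ : ι × Mon n) :
    ι → MvPolynomial (Fin (n + 1)) S :=
  open Classical in Pi.single σ.1 (MvPolynomial.monomial σ.2 1)

/-- `x^β e_ℓ` (`= σ`) lies in the Pommaret cone of `x^α e_k` (`= τ`). -/
def InCone {n : ℕ} {ι : Type} (τ σ : ι × Mon n) : Prop :=
  σ.1 = τ.1 ∧ ∃ δ : Mon n, (∀ j ∈ δ.support, j ≤ minVar τ.2) ∧ σ.2 = δ + τ.2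

/-- `T` is a finite Pommaret basis of the submodule `U` of `K[x_0,…,x_n]^m`: the terms in `T`
generate `U`, and the set of terms lying in `U` is the disjoint union of the Pommaret cones of the
elements of `T`. A submodule with a finite Pommaret basis is what is called quasi-stable. -/
structure IsPommaretBasis {n m : ℕ} {K : Type u} [Field K]
    (U : Submodule (MvPolynomial (Fin (n + 1)) K) (Fin m → MvPolynomial (Fin (n + 1)) K))
    (T : Finset (Fin m × Mon n)) : Prop where
  span_eq : Submodule.span (MvPolynomial (Fin (n + 1)) K) (term K '' (T : Set (Fin m × Mon n))) = U
  mem_iff : ∀ σ : Fin m × Mon n, term K σ ∈ U ↔ ∃ τ ∈ T, InCone τ σ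
  disjoint : ∀ τ ∈ T, ∀ τ' ∈ T, ∀ σ : Fin m × Mon n, InCone τ σ → InCone τ' σ → τ = τ'

/-- The combinatorial data of a free graded module `⊕_{k ∈ ι} R(-d_k) e_k` together with a finite
family of terms `x^{exp τ} e_{comp τ}`, `τ ∈ P`, the Pommaret basis of a monomial submodule. -/
structure Shape (n : ℕ) where
  ι : Type
  d : ι → ℤ
  P : Type
  comp : P → ι
  exp : P → Mon n
  [fintypeι : Fintype ι]
  [fintypeP : Fintype P]

attribute [instance] Shape.fintypeι Shape.fintypeP

namespace Shape

/-- The shape of `T ⊆ R^m(-d)`. -/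
def ofFinset {n m : ℕ} (d : Fin m → ℤ) (T : Finset (Fin m × Mon n)) : Shape n where
  ι := Fin m
  d := d
  P := T
  comp := fun τ => τ.1.1
  exp := fun τ => τ.1.2

variable {n : ℕ} (X : Shape n)

/-- Pairs `(k, η)`, standing for the terms `x^η e_k`. -/
abbrev Term : Type := X.ι × Mon n

/-- The element of the Pommaret basis indexed by `τ`. -/
def head (τ : X.P) : X.Term := (X.comp τ, X.exp τ)

/-- Degree of a term in `⊕ R(-d_k) e_k`. -/
def deg (σ : X.Term) : ℤ := (σ.2.degree : ℤ) + X.d σ.1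

/-- The sous-escalier: the terms outside the monomial module generated by the Pommaret basis,
i.e. divisible by none of its elements (see `mem_escalier_iff`). -/
def escalier : Set X.Term := {σ | ∀ τ : X.P, X.comp τ = σ.1 → ¬ X.exp τ ≤ σ.2}

/-- The shape of the module of first syzygies: the basis is `f_τ`, `τ ∈ P`, with
`deg f_τ = deg (head τ)`, and the Pommaret basis is `{x_i f_τ | x_i > min (x^{exp τ})}`, indexed by
the pairs of an element of `P` and one of its non-multiplicative variables. -/
def next : Shape n where
  ι := X.P
  d := fun τ => X.deg (X.head τ)
  P := Σ τ : X.P, {i : Fin (n + 1) // minVar (X.exp τ) < i}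
  comp := fun ρ => ρ.1
  exp := fun ρ => Finsupp.single ρ.2.1 1

/-- The shape of the module `U^(t)` of the `t`-th syzygies (`U^(0) = U`). -/
def iter : ℕ → Shape n
  | 0 => X
  | t + 1 => (iter t).next

/-- The least index of a variable `min (x^α)`, for `x^α e_k` in the Pommaret basis. -/
def D : Fin (n + 1) := Finset.univ.inf fun τ : X.P => minVar (X.exp τ)

/-- The length `n - D` of the resolution. -/
def len : ℕ := n - (X.D : ℕ)

/-- For `ρ = x_i f_α` and a term `x^η f_γ`, the condition that `x^η x^γ` is in the `i`-sliced
Pommaret cone of `x^γ`: the variables of `x^η` are `≤ min {x_{i-1}, min (x^γ)}`. -/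
def Sliced (ρ : X.next.P) (σ : X.next.Term) : Prop :=
  ∀ j ∈ σ.2.support, j < ρ.2.1 ∧ j ≤ minVar (X.exp σ.1)

/-- The pairs (element `ρ` of the Pommaret basis of `U^(t)`, term `σ`) that carry a parameter:
`σ` is a term of `N(U^(t))` of the same degree as `ρ`, and for `t > 0` it satisfies moreover the
restriction given by the sliced Pommaret cones. -/
def IsPar : (t : ℕ) → (X.iter t).P → (X.iter t).Term → Prop
  | 0, τ, σ => σ ∈ X.escalier ∧ X.deg σ = X.deg (X.head τ)
  | t + 1, ρ, σ => (X.iter t).Sliced ρ σ ∧ σ ∈ (X.iter t).next.escalier ∧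
      (X.iter t).next.deg σ = (X.iter t).next.deg ((X.iter t).next.head ρ)

/-- The parameters: `C` for `t = 0`, and `B^(t)` for `t > 0`. -/
def Par (t : ℕ) : Type := {p : (X.iter t).P × (X.iter t).Term // X.IsPar t p.1 p.2}

/-- All the parameters `C, B^(1), …, B^(n-D)`. -/
abbrev Tot : Type := Σ t : Fin (X.len + 1), X.Par t

theorem finite_deg_eq (z : ℤ) : {σ : X.Term | X.deg σ = z}.Finite := by
  have h : ∀ k : X.ι, {η : Mon n | (η.degree : ℤ) + X.d k = z}.Finite := fun k =>
    (Finsupp.finite_of_degree_le (σ := Fin (n + 1)) (z - X.d k).toNat).subset (by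
      intro η hη
      simp only [Set.mem_ofPred_eq] at hη ⊢
      omega)
  refine ((Set.finite_univ (α := X.ι)).biUnion fun k _ => (h k).image (Prod.mk k)).subset ?_
  rintro ⟨k, η⟩ hσ
  simp only [Set.mem_iUnion, Set.mem_image]
  exact ⟨k, Set.mem_univ k, η, hσ, rfl⟩

theorem deg_eq_of_isPar : ∀ (t : ℕ) (ρ : (X.iter t).P) (σ : (X.iter t).Term), X.IsPar t ρ σ →
    (X.iter t).deg σ = (X.iter t).deg ((X.iter t).head ρ)
  | 0, _, _, h => h.2
  | _ + 1, _, _, h => h.2.2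

instance (t : ℕ) : Finite (X.Par t) := by
  have : {p : (X.iter t).P × (X.iter t).Term | X.IsPar t p.1 p.2}.Finite := by
    refine ((Set.finite_univ (α := (X.iter t).P)).biUnion fun ρ _ =>
      ((X.iter t).finite_deg_eq ((X.iter t).deg ((X.iter t).head ρ))).image (Prod.mk ρ)).subset ?_
    rintro ⟨ρ, σ⟩ h
    simp only [Set.mem_iUnion, Set.mem_image]
    exact ⟨ρ, Set.mem_univ ρ, σ, X.deg_eq_of_isPar t ρ σ h, rfl⟩
  exact this.to_subtype

instance (t : ℕ) : Fintype (X.Par t) := Fintype.ofFinite _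

/-- The matrix whose column of index `ρ` is `ρ - ∑ v_{ρ,σ} σ` (with head term `ρ`), the sum being
over the terms `σ` that carry a parameter for `ρ`, with values `v` of the parameters in `S`.
For `t = 0` the columns are the marked set with parameter values `v`; for `t > 0` they are the
fundamental pre-syzygies with parameter values `v`. -/
def mat {S : Type*} [CommRing S] (t : ℕ) (v : X.Par t → S) :
    Matrix (X.iter t).ι (X.iter t).P (MvPolynomial (Fin (n + 1)) S) :=
  Matrix.of fun k ρ => term S ((X.iter t).head ρ) k -
    ∑ p : X.Par t, open Classical in
      if p.1.1 = ρ then MvPolynomial.C (v p) * term S p.1.2 k else 0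

section Ring

variable {A : Type*} [CommRing A]

/-- The free module `⊕ R_A(-d_k) e_k`, `R_A = A[x_0,…,x_n]`. -/
abbrev Free (A : Type*) [CommRing A] : Type _ := X.ι → MvPolynomial (Fin (n + 1)) A

/-- `f` is homogeneous of degree `s` (or zero). -/
def IsHomog (f : X.Free A) (s : ℤ) : Prop :=
  ∀ σ : X.Term, (f σ.1).coeff σ.2 ≠ 0 → X.deg σ = s

/-- The component of degree `s` of the free module, as an `A`-module. -/
def degPart (A : Type*) [CommRing A] (s : ℤ) : Submodule A (X.Free A) where
  carrier := {f | X.IsHomog f s}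
  zero_mem' := fun σ h => absurd (by simp) h
  add_mem' := by
    intro f g hf hg σ h
    by_cases h1 : (f σ.1).coeff σ.2 = 0
    · refine hg σ fun h2 => h ?_
      simp [h1, h2]
    · exact hf σ h1
  smul_mem' := by
    intro a f hf σ h
    refine hf σ fun h1 => h ?_
    simp [h1]

/-- The `A`-module `⟨N(U)⟩` generated by the sous-escalier. -/
def escSpan (A : Type*) [CommRing A] : Submodule A (X.Free A) :=
  Submodule.span A (term A '' X.escalier)

/-- The `A`-module `⟨N(U)_s⟩`. -/
def escSpanDeg (A : Type*) [CommRing A] (s : ℤ) : Submodule A (X.Free A) :=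
  Submodule.span A (term A '' {σ | σ ∈ X.escalier ∧ X.deg σ = s})

/-- The submodule generated by the columns of a matrix. -/
def colSpan (F : Matrix X.ι X.P (MvPolynomial (Fin (n + 1)) A)) :
    Submodule (MvPolynomial (Fin (n + 1)) A) (X.Free A) :=
  Submodule.span _ (Set.range F.col)

/-- The columns of `F` form a marked set: the column of index `τ` is homogeneous, the head term
`head τ` has coefficient `1` in it, and all its other terms are in the sous-escalier. -/
structure IsMarkedSet (F : Matrix X.ι X.P (MvPolynomial (Fin (n + 1)) A)) : Prop where
  homog : ∀ τ : X.P, X.IsHomog (F.col τ) (X.deg (X.head τ))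
  coeff_head : ∀ τ : X.P, (F (X.comp τ) τ).coeff (X.exp τ) = 1
  supp : ∀ (τ : X.P) (σ : X.Term), (F σ.1 τ).coeff σ.2 ≠ 0 → σ = X.head τ ∨ σ ∈ X.escalier

/-- The columns of `F` form a marked basis: they are a marked set and, in every degree `s`, the
free module is `(F)_s ⊕ ⟨N(U)_s⟩`. -/
structure IsMarkedBasis (F : Matrix X.ι X.P (MvPolynomial (Fin (n + 1)) A)) : Prop
    extends X.IsMarkedSet F where
  disjoint : ∀ s : ℤ, Disjoint ((X.colSpan F).restrictScalars A ⊓ X.degPart A s) (X.escSpanDeg A s)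
  sup_eq : ∀ s : ℤ,
    ((X.colSpan F).restrictScalars A ⊓ X.degPart A s) ⊔ X.escSpanDeg A s = X.degPart A s

/-- `M` is an element of the marked functor at `A`: a graded submodule (`M = ⊕ M_s`) with
`M ⊕ ⟨N(U)⟩` equal to the whole free module. -/
structure IsMarkedModule (M : Submodule (MvPolynomial (Fin (n + 1)) A) (X.Free A)) : Prop where
  graded : ⨆ s : ℤ, M.restrictScalars A ⊓ X.degPart A s = M.restrictScalars A
  isCompl : IsCompl (M.restrictScalars A) (X.escSpan A)

/-- The support condition on coefficients `P_γ` in the unique writing with respect to a marked set: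
`supp (P_γ x^γ)` is contained in the Pommaret cone of `x^γ`. -/
def ConeSupported (Q : X.P → MvPolynomial (Fin (n + 1)) A) : Prop :=
  ∀ γ : X.P, ∀ η ∈ (Q γ).support, InCone (X.head γ) (X.comp γ, η + X.exp γ)

/-- `g` is the normal form of `f` with respect to the marked set `F`: `g ∈ ⟨N(U)⟩` and
`f = ∑ P_γ F_γ + g` with `supp (P_γ x^γ)` in the cone of `x^γ`. -/
def IsNormalForm (F : Matrix X.ι X.P (MvPolynomial (Fin (n + 1)) A)) (f g : X.Free A) : Prop :=
  g ∈ X.escSpan A ∧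
    ∃ Q : X.P → MvPolynomial (Fin (n + 1)) A, X.ConeSupported Q ∧ f = F.mulVec Q + g

/-- The columns of `G` are the fundamental syzygies of (the columns of) `F`: the one of index
`ρ = (τ, x_i)` is `x_i f_τ - ∑ P_γ f_γ`, where `x_i F_τ = ∑ P_γ F_γ` with `supp (P_γ x^γ)` in the
cone of `x^γ`. -/
def IsFundSyz (F : Matrix X.ι X.P (MvPolynomial (Fin (n + 1)) A))
    (G : Matrix X.next.ι X.next.P (MvPolynomial (Fin (n + 1)) A)) : Prop :=
  ∀ ρ : X.next.P, ∃ Q : X.P → MvPolynomial (Fin (n + 1)) A, X.ConeSupported Q ∧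
    (MvPolynomial.X ρ.2.1 : MvPolynomial (Fin (n + 1)) A) • F.col ρ.1 = F.mulVec Q ∧
    ∀ γ : X.P, G γ ρ = term A (X.next.head ρ) γ - Q γ

/-- The syzygy module of (the columns of) `F`. -/
def syz (F : Matrix X.ι X.P (MvPolynomial (Fin (n + 1)) A)) :
    Submodule (MvPolynomial (Fin (n + 1)) A) (X.next.Free A) :=
  LinearMap.ker (Matrix.mulVecLin F)

/-- Families `(M = S_0, S_1, …, S_{n-D})` of submodules of the free modules of the resolution. -/
abbrev Tuple (A : Type*) [CommRing A] : Type _ :=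
  ∀ t : Fin (X.len + 1), Submodule (MvPolynomial (Fin (n + 1)) A) ((X.iter t).Free A)

/-- The tuple `(M, S_1, …, S_{n-D})` is an element of the marked resolution functor at `A`:
`M` is graded with `M ⊕ ⟨N(U)⟩` equal to the whole free module and, `F^(0)` being the marked basis
generating `M` and `F^(t+1)` the set of the fundamental syzygies of `F^(t)`, the module `S_{t+1}`
is the syzygy module of `F^(t)` for every `t < n - D`. -/
def IsRes (S : X.Tuple A) : Prop :=
  X.IsMarkedModule (S 0) ∧
  ∃ F : ∀ t : ℕ, Matrix (X.iter t).ι (X.iter t).P (MvPolynomial (Fin (n + 1)) A),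
    X.IsMarkedBasis (F 0) ∧ X.colSpan (F 0) = S 0 ∧
    ∀ (t : ℕ) (ht : t < X.len),
      (X.iter t).IsFundSyz (F t) (F (t + 1)) ∧
      S ⟨t + 1, Nat.succ_lt_succ ht⟩ = (X.iter t).syz (F t)

/-- The coefficientwise extension of a ring homomorphism to vectors of polynomials. -/
def mapVec {A' : Type*} [CommRing A'] {ι : Type} (f : A →+* A')
    (w : ι → MvPolynomial (Fin (n + 1)) A) : ι → MvPolynomial (Fin (n + 1)) A' :=
  fun k => MvPolynomial.map f (w k)

/-- Extension of scalars: the submodule generated by the image of `M`. -/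
def extend {A' : Type*} [CommRing A'] {ι : Type} (f : A →+* A')
    (M : Submodule (MvPolynomial (Fin (n + 1)) A) (ι → MvPolynomial (Fin (n + 1)) A)) :
    Submodule (MvPolynomial (Fin (n + 1)) A') (ι → MvPolynomial (Fin (n + 1)) A') :=
  Submodule.span _ (mapVec f '' (M : Set (ι → MvPolynomial (Fin (n + 1)) A)))

theorem extend_id {ι : Type}
    (M : Submodule (MvPolynomial (Fin (n + 1)) A) (ι → MvPolynomial (Fin (n + 1)) A)) :
    extend (RingHom.id A) M = M := by
  have : (mapVec (RingHom.id A) : (ι → MvPolynomial (Fin (n + 1)) A) → _) = id := by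
    funext w k
    exact MvPolynomial.map_id (w k)
  simp [extend, this]

theorem extend_comp {A' A'' : Type*} [CommRing A'] [CommRing A''] {ι : Type}
    (f : A →+* A') (g : A' →+* A'')
    (M : Submodule (MvPolynomial (Fin (n + 1)) A) (ι → MvPolynomial (Fin (n + 1)) A)) :
    extend (g.comp f) M = extend g (extend f M) := by
  have hcomp : ∀ w : ι → MvPolynomial (Fin (n + 1)) A,
      mapVec (g.comp f) w = mapVec g (mapVec f w) := by
    intro w
    funext k
    simp [mapVec, MvPolynomial.map_map]
  apply le_antisymm
  · refine Submodule.span_le.2 ?_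
    rintro _ ⟨w, hw, rfl⟩
    rw [hcomp]
    exact Submodule.subset_span ⟨_, Submodule.subset_span ⟨w, hw, rfl⟩, rfl⟩
  · refine Submodule.span_le.2 ?_
    rintro _ ⟨w, hw, rfl⟩
    refine Submodule.span_induction (p := fun w _ => mapVec g w ∈ extend (g.comp f) M)
      ?_ ?_ ?_ ?_ hw
    · rintro _ ⟨y, hy, rfl⟩
      rw [← hcomp]
      exact Submodule.subset_span ⟨y, hy, rfl⟩
    · have : mapVec g (0 : ι → MvPolynomial (Fin (n + 1)) A') = 0 := by
        funext k
        simp [mapVec]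
      rw [this]
      exact Submodule.zero_mem _
    · intro y z _ _ hy hz
      have : mapVec g (y + z) = mapVec g y + mapVec g z := by
        funext k
        simp [mapVec]
      rw [this]
      exact Submodule.add_mem _ hy hz
    · intro a y _ hy
      have : mapVec g (a • y) = MvPolynomial.map g a • mapVec g y := by
        funext k
        simp [mapVec]
      rw [this]
      exact Submodule.smul_mem _ _ hy

end Ring

/-- The sous-escalier is the set of the terms that do not belong to the monomial module generated
by the terms `head τ`. -/
theorem mem_escalier_iff {A : Type*} [CommRing A] [Nontrivial A] (σ : X.Term) :
    σ ∈ X.escalier ↔ term A σ ∉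
      Submodule.span (MvPolynomial (Fin (n + 1)) A) (Set.range fun τ : X.P => term A (X.head τ)) := by
  classical
  rw [← not_iff_not, not_not]
  constructor
  · intro h
    simp only [escalier, Set.mem_ofPred_eq, not_forall, not_not] at h
    obtain ⟨τ, h1, h2⟩ := h
    have : term A σ = (MvPolynomial.monomial (σ.2 - X.exp τ) (1 : A)) • term A (X.head τ) := by
      rw [term, term, ← Pi.single_smul, smul_eq_mul, MvPolynomial.monomial_mul, one_mul]
      simp only [head, h1]
      rw [tsub_add_cancel_of_le h2]
    rw [this]
    exact Submodule.smul_mem _ _ (Submodule.subset_span ⟨τ, rfl⟩)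
  · intro h
    have h1 := Submodule.mem_map_of_mem (f := LinearMap.proj (R := MvPolynomial (Fin (n + 1)) A)
      (φ := fun _ : X.ι => MvPolynomial (Fin (n + 1)) A) σ.1) h
    rw [Submodule.map_span] at h1
    have h2 : Submodule.span (MvPolynomial (Fin (n + 1)) A)
        ((LinearMap.proj (R := MvPolynomial (Fin (n + 1)) A)
          (φ := fun _ : X.ι => MvPolynomial (Fin (n + 1)) A) σ.1) ''
            (Set.range fun τ : X.P => term A (X.head τ))) ≤
        Ideal.span ((fun s => MvPolynomial.monomial s (1 : A)) ''
          (X.exp '' {τ | X.comp τ = σ.1})) := by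
      refine Submodule.span_le.2 ?_
      rintro _ ⟨_, ⟨τ, rfl⟩, rfl⟩
      by_cases hτ : X.comp τ = σ.1
      · refine Submodule.subset_span ⟨X.exp τ, ⟨τ, hτ, rfl⟩, ?_⟩
        simp [term, head, hτ]
      · have : (LinearMap.proj (R := MvPolynomial (Fin (n + 1)) A)
          (φ := fun _ : X.ι => MvPolynomial (Fin (n + 1)) A) σ.1) (term A (X.head τ)) = 0 := by
          simp [term, head, Ne.symm hτ]
        rw [this]
        exact Submodule.zero_mem _
    have h3 := MvPolynomial.mem_ideal_span_monomial_image.1 (h2 h1) σ.2 (by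
      simp [term])
    obtain ⟨_, ⟨τ, hτ, rfl⟩, hle⟩ := h3
    simp only [escalier, Set.mem_ofPred_eq, not_forall, not_not]
    exact ⟨τ, hτ, hle⟩

section Equations

variable (K : Type u) [Field K]

/-- The generic marked set `ℱ`, over `K[C]`. -/
def genericMat : Matrix X.ι X.P (MvPolynomial (Fin (n + 1)) (MvPolynomial (X.Par 0) K)) :=
  X.mat 0 MvPolynomial.X

/-- The ideal `𝒰 ⊆ K[C]` generated by the coefficients of the normal forms of `x_i F_τ` with
respect to the generic marked set, for all `τ` and all non-multiplicative variables `x_i`. -/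
def idealU : Ideal (MvPolynomial (X.Par 0) K) :=
  Ideal.span {c | ∃ (τ : X.P) (i : Fin (n + 1)) (g : X.Free (MvPolynomial (X.Par 0) K))
    (σ : X.Term), minVar (X.exp τ) < i ∧
      X.IsNormalForm (X.genericMat K)
        ((MvPolynomial.X i : MvPolynomial (Fin (n + 1)) (MvPolynomial (X.Par 0) K)) •
          (X.genericMat K).col τ) g ∧
      c = (g σ.1).coeff σ.2}

/-- The polynomial ring `K[C, B^(1), …, B^(n-D)]`. -/
abbrev TotRing : Type u := MvPolynomial X.Tot K

/-- The inclusion of `K[B^(t)]` (of `K[C]` for `t = 0`) in `K[C, B^(1), …, B^(n-D)]`. -/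
def incl (t : Fin (X.len + 1)) : MvPolynomial (X.Par t) K →ₐ[K] X.TotRing K :=
  MvPolynomial.rename fun p => (⟨t, p⟩ : X.Tot)

/-- The matrix `M_t` over `K[C, B^(1), …, B^(n-D)][x_0, …, x_n]`. -/
def genM (t : Fin (X.len + 1)) :
    Matrix (X.iter t).ι (X.iter t).P (MvPolynomial (Fin (n + 1)) (X.TotRing K)) :=
  X.mat t fun p => MvPolynomial.X ⟨t, p⟩

/-- The product `M_t M_{t+1}`; the columns of `M_t` are indexed, as the rows of `M_{t+1}`, by the
Pommaret basis of `U^(t)`. -/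
def prodM (t : ℕ) (ht : t < X.len) :
    Matrix (X.iter t).ι (X.iter (t + 1)).P (MvPolynomial (Fin (n + 1)) (X.TotRing K)) :=
  let M : Matrix (X.iter t).ι (X.iter t).P (MvPolynomial (Fin (n + 1)) (X.TotRing K)) :=
    X.genM K ⟨t, Nat.lt_succ_of_lt ht⟩
  let M' : Matrix (X.iter t).P (X.iter (t + 1)).P (MvPolynomial (Fin (n + 1)) (X.TotRing K)) :=
    X.genM K ⟨t + 1, Nat.succ_lt_succ ht⟩
  M * M'

/-- The ideal `𝒮^(t+1)` generated by the coefficients of the entries of `M_t M_{t+1}`. -/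
def idealS (t : ℕ) (ht : t < X.len) : Ideal (X.TotRing K) :=
  Ideal.span {c | ∃ (k : (X.iter t).ι) (ρ : (X.iter (t + 1)).P) (η : Mon n),
    c = (X.prodM K t ht k ρ).coeff η}

/-- The ideal `𝒮^(1) + ⋯ + 𝒮^(n-D)`. -/
def idealSum : Ideal (X.TotRing K) := ⨆ t : Fin X.len, X.idealS K t t.2

/-- The algebra `K[C]/𝒰`. -/
abbrev MfAlg : Type u := MvPolynomial (X.Par 0) K ⧸ X.idealU K

/-- The algebra `K[C, B^(1), …, B^(n-D)]/(𝒮^(1) + ⋯ + 𝒮^(n-D))`. -/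
abbrev ResAlg : Type u := X.TotRing K ⧸ X.idealSum K

end Equations

end Shape

/-- The category of Noetherian `K`-algebras. -/
abbrev NoethAlg (K : Type u) [Field K] : Type (u + 1) :=
  ObjectProperty.FullSubcategory fun A : CommAlgCat.{u} K => IsNoetherianRing A

namespace Shape

variable {n : ℕ} (X : Shape n) (K : Type u) [Field K]

/-- The marked resolution functor is well defined on morphisms: extension of scalars along every
homomorphism of Noetherian `K`-algebras carries elements of the functor to elements of the
functor. -/
def ResStable : Prop :=
  ∀ (A A' : NoethAlg K) (f : A ⟶ A') (S : X.Tuple A.obj), X.IsRes S →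
    X.IsRes (A := A'.obj) fun t => extend (f.hom.hom : A.obj →+* A'.obj) (S t)

/-- The marked resolution functor from Noetherian `K`-algebras to sets. -/
def resFunctor (h : X.ResStable K) : NoethAlg K ⥤ Type u where
  obj A := {S : X.Tuple A.obj // X.IsRes S}
  map {A A'} f := TypeCat.ofHom fun S =>
    ⟨fun t => extend (f.hom.hom : A.obj →+* A'.obj) (S.1 t), h A A' f S.1 S.2⟩
  map_id A := by
    apply ConcreteCategory.hom_ext
    intro S
    apply Subtype.ext
    funext t
    exact extend_id _
  map_comp {A A' A''} f g := by
    apply ConcreteCategory.hom_ext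
    intro S
    apply Subtype.ext
    funext t
    exact extend_comp _ _ _

/-- The algebra `K[C, B^(1), …, B^(n-D)]/(𝒮^(1) + ⋯ + 𝒮^(n-D))` as a Noetherian `K`-algebra. -/
def resObj : NoethAlg K where
  obj := CommAlgCat.of K (X.ResAlg K)
  property := inferInstanceAs (IsNoetherianRing (X.TotRing K ⧸ X.idealSum K))

end Shape

end

end MarkedRes

/-! The argument is division by marked sets, with termination measured on cofactors. Order exponents
colexicographically, the largest variable being most significant. If `x^δ x^σ` lies in the cone of
`x^γ` with multiplicative cofactor `x^δ'`, and `x^σ` is outside the monomial module, then `δ' < δ`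
(`clx_lt_of_mem_escalier`). So replacing a head by the tail of its marked element lowers the
cofactors. This gives existence of normal forms (`term_mem_reducible`). A largest cofactor cannot
cancel, which gives uniqueness (`eq_zero_of_mulVec_add_eq_zero`), over any coefficient ring.

The recursion rests on `next_escalier`: a cone-supported vector of cofactors for `U^(t)` is a vector
supported on the sous-escalier of `U^(t+1)`. Fundamental syzygies therefore form a marked set for
`U^(t+1)`. Dividing a syzygy by them leaves a cone-supported syzygy, which vanishes by uniqueness.
Hence they generate the syzygy module and have fundamental syzygies of their own
(`exists_mult_of_mem_syz`, `IsFundSyz.exists_next`).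

The restriction imposed on the `B^(t)` is satisfied by every fundamental syzygy, because the
cofactors in the division of `x_i F_τ` are smaller than `x_i`. So `M_t M_{t+1} = 0` says exactly
that the columns of `M_{t+1}` are the fundamental syzygies of those of `M_t` (`isFundSyz_mat_iff`).
Each matrix determines the next, so points of the functor are solutions of these equations, and a
solution is determined by its values on `C`. Such values extend to a solution as soon as the normal
forms of the `x_i F_τ` vanish, which is the vanishing of `𝒰`. -/

namespace MarkedRes

noncomputable section

/-! ### Colexicographic order on cofactors -/

/-- Exponents of terms, ordered with the largest variable most significant. -/
def clx {n : ℕ} (a : Mon n) : Colex (Fin (n + 1) → ℕ) := toColex fun i => a i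

theorem clx_lt_iff {n : ℕ} {a b : Mon n} :
    clx a < clx b ↔ ∃ i, (∀ j, i < j → a j = b j) ∧ a i < b i := Iff.rfl

theorem clx_injective {n : ℕ} : Function.Injective (clx (n := n)) := fun _ _ h =>
  Finsupp.ext fun i => congrFun (congrArg ofColex h) i

theorem clx_add_lt_clx_add {n : ℕ} {a b : Mon n} (c : Mon n) (h : clx a < clx b) :
    clx (c + a) < clx (c + b) := by
  rw [clx_lt_iff] at h ⊢
  obtain ⟨i, h1, h2⟩ := h
  exact ⟨i, fun j hj => by simp [h1 j hj], by simpa using h2⟩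

theorem clx_wellFounded {n : ℕ} : WellFounded fun a b : Mon n => clx a < clx b :=
  InvImage.wf clx wellFounded_lt

theorem lt_of_clx_lt_single {n : ℕ} {a : Mon n} {i : Fin (n + 1)}
    (h : clx a < clx (Finsupp.single i 1)) : ∀ j ∈ a.support, j < i := by
  rw [clx_lt_iff] at h
  obtain ⟨k, h1, h2⟩ := h
  have hk : k = i := by
    by_contra hne
    rw [Finsupp.single_eq_of_ne hne] at h2
    omega
  subst hk
  intro j hj
  by_contra hlt
  rw [Finsupp.mem_support_iff] at hj
  rcases lt_or_eq_of_le (not_lt.1 hlt) with h3 | h3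
  · rw [h1 j h3, Finsupp.single_eq_of_ne h3.ne'] at hj
    exact hj rfl
  · subst h3
    simp at h2
    exact hj h2

theorem minVar_le {n : ℕ} {α : Mon n} {j : Fin (n + 1)} (h : α j ≠ 0) : minVar α ≤ j :=
  Finset.inf_le (f := id) (Finsupp.mem_support_iff.2 h)

/-- If `x^δ x^σ` lies in the Pommaret cone of `x^τ`, with cofactor `x^δ'`, then either `δ'` is
smaller than `δ`, or `x^σ` already lies in that cone. -/
theorem clx_lt_or_exists_add {n : ℕ} {δ σ δ' τ : Mon n} (h : δ + σ = δ' + τ)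
    (hδ' : ∀ j ∈ δ'.support, j ≤ minVar τ) :
    clx δ' < clx δ ∨ ∃ ε : Mon n, σ = ε + τ ∧ δ' = δ + ε := by
  rcases lt_trichotomy (clx δ') (clx δ) with h1 | h1 | h1
  · exact Or.inl h1
  · have h2 := clx_injective h1
    subst h2
    exact Or.inr ⟨0, by simpa using h, by simp⟩
  · right
    obtain ⟨i, hi, hlt⟩ := clx_lt_iff.1 h1
    have him : i ≤ minVar τ := hδ' i (Finsupp.mem_support_iff.2 (by omega))
    -- Above `i` the exponents agree and at `i` the inequality is strict. Below `i`, `x^τ` has no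
    -- variable because `i ≤ minVar τ`, so `δ' j = δ j + σ j`.
    have hle : δ ≤ δ' := by
      intro j
      rcases lt_trichotomy j i with hj | hj | hj
      · have h3 : τ j = 0 := by
          by_contra hne
          exact absurd (minVar_le hne) (not_le.2 (hj.trans_le him))
        have h4 := DFunLike.congr_fun h j
        simp only [Finsupp.add_apply] at h4
        omega
      · exact hj ▸ hlt.le
      · exact (hi j hj).le
    refine ⟨δ' - δ, ?_, (add_tsub_cancel_of_le hle).symm⟩
    apply add_left_cancel (a := δ)
    rw [h, ← add_assoc, add_tsub_cancel_of_le hle]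

/-! ### Vectors of polynomials with prescribed support -/

section SuppIn

variable {n : ℕ} {ι : Type} {A : Type*} [CommRing A]

theorem coeff_term (σ : ι × Mon n) (k : ι) (η : Mon n) [Decidable ((k, η) = σ)] :
    (term A σ k).coeff η = if (k, η) = σ then 1 else 0 := by
  classical
  obtain ⟨k', η'⟩ := σ
  by_cases hk : k = k'
  · subst hk
    simp [term, MvPolynomial.coeff_monomial, eq_comm]
  · simp [term, hk]

/-- The vectors of polynomials whose terms all belong to `E`. -/
def suppIn (A : Type*) [CommRing A] (E : Set (ι × Mon n)) :
    Submodule A (ι → MvPolynomial (Fin (n + 1)) A) where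
  carrier := {f | ∀ k η, (f k).coeff η ≠ 0 → (k, η) ∈ E}
  zero_mem' := fun k η h => absurd (by simp) h
  add_mem' := by
    intro f g hf hg k η h
    by_cases h1 : (f k).coeff η = 0
    · refine hg k η fun h2 => h ?_
      simp [h1, h2]
    · exact hf k η h1
  smul_mem' := by
    intro a f hf k η h
    refine hf k η fun h1 => h ?_
    simp [h1]

theorem suppIn_mono {E E' : Set (ι × Mon n)} (h : E ⊆ E') : suppIn A E ≤ suppIn A E' :=
  fun _ hf k η hne => h (hf k η hne)

theorem mem_suppIn_univ (f : ι → MvPolynomial (Fin (n + 1)) A) : f ∈ suppIn A Set.univ :=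
  fun _ _ _ => trivial

theorem term_mem_suppIn {E : Set (ι × Mon n)} {σ : ι × Mon n} (h : σ ∈ E) :
    term A σ ∈ suppIn A E := by
  classical
  intro k η hne
  rw [coeff_term] at hne
  have h1 : (k, η) = σ := by
    by_contra h2
    simp [h2] at hne
  rwa [h1]

theorem sum_coeff_smul_term [Fintype ι] (f : ι → MvPolynomial (Fin (n + 1)) A) :
    f = ∑ k, ∑ η ∈ (f k).support, (f k).coeff η • term A (k, η) := by
  classical
  funext k
  ext η
  simp only [Finset.sum_apply, Pi.smul_apply, MvPolynomial.coeff_sum, MvPolynomial.coeff_smul,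
    coeff_term, Prod.mk.injEq, smul_eq_mul]
  rw [Finset.sum_eq_single k]
  · rw [Finset.sum_eq_single η]
    · simp
    · intro η' _ hne
      simp [hne.symm]
    · intro hη
      simpa using hη
  · intro k' _ hne
    simp [hne.symm]
  · simp

/-- A vector is the `A`-linear combination of its terms. All the division arguments below use this
to reduce to a single term. -/
theorem suppIn_le [Finite ι] {E : Set (ι × Mon n)}
    {N : Submodule A (ι → MvPolynomial (Fin (n + 1)) A)} (h : ∀ σ ∈ E, term A σ ∈ N) :
    suppIn A E ≤ N := by
  have := Fintype.ofFinite ι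
  intro f hf
  rw [sum_coeff_smul_term f]
  refine Submodule.sum_mem _ fun k _ => Submodule.sum_mem _ fun η hη => ?_
  exact N.smul_mem _ (h _ (hf k η (MvPolynomial.mem_support_iff.1 hη)))

theorem span_term_image [Finite ι] (E : Set (ι × Mon n)) :
    Submodule.span A (term A '' E) = suppIn A E := by
  apply le_antisymm
  · rw [Submodule.span_le]
    rintro _ ⟨σ, hσ, rfl⟩
    exact term_mem_suppIn hσ
  · exact suppIn_le fun σ hσ => Submodule.subset_span ⟨σ, hσ, rfl⟩

theorem monomial_smul_mem_suppIn {E : Set (ι × Mon n)} {f : ι → MvPolynomial (Fin (n + 1)) A}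
    (hf : f ∈ suppIn A E) (δ : Mon n) (a : A) :
    MvPolynomial.monomial δ a • f ∈ suppIn A ((fun σ : ι × Mon n => (σ.1, δ + σ.2)) '' E) := by
  intro k η hne
  rw [Pi.smul_apply, smul_eq_mul, MvPolynomial.coeff_monomial_mul'] at hne
  by_cases hle : δ ≤ η
  · rw [if_pos hle] at hne
    exact ⟨(k, η - δ), hf _ _ (right_ne_zero_of_mul hne), by simp [add_tsub_cancel_of_le hle]⟩
  · rw [if_neg hle] at hne
    exact absurd rfl hne

theorem monomial_smul_term (δ : Mon n) (σ : ι × Mon n) :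
    MvPolynomial.monomial δ (1 : A) • term A σ = term A (σ.1, δ + σ.2) := by
  classical
  rw [term, term, ← Pi.single_smul, smul_eq_mul, MvPolynomial.monomial_mul, one_mul]

theorem mulVec_term {κ : Type} [Fintype ι] (F : Matrix κ ι (MvPolynomial (Fin (n + 1)) A))
    (σ : ι × Mon n) :
    F.mulVec (term A σ) = MvPolynomial.monomial σ.2 (1 : A) • F.col σ.1 := by
  classical
  funext k
  simp [term, mul_comm, Matrix.mulVec_single]

theorem mapVec_mem_suppIn {A' : Type*} [CommRing A'] (f : A →+* A') {E : Set (ι × Mon n)}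
    {w : ι → MvPolynomial (Fin (n + 1)) A} (hw : w ∈ suppIn A E) :
    Shape.mapVec f w ∈ suppIn A' E := by
  intro k η hne
  refine hw k η fun h => hne ?_
  simp [Shape.mapVec, MvPolynomial.coeff_map, h]

theorem mapVec_mulVec {A' : Type*} [CommRing A'] (f : A →+* A') {κ : Type} [Fintype ι]
    (F : Matrix κ ι (MvPolynomial (Fin (n + 1)) A)) (w : ι → MvPolynomial (Fin (n + 1)) A) :
    Shape.mapVec f (F.mulVec w) = (F.map (MvPolynomial.map f)).mulVec (Shape.mapVec f w) := by
  funext k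
  simp [Shape.mapVec, Matrix.mulVec, dotProduct]

theorem mapVec_add {A' : Type*} [CommRing A'] (f : A →+* A')
    (v w : ι → MvPolynomial (Fin (n + 1)) A) :
    Shape.mapVec f (v + w) = Shape.mapVec f v + Shape.mapVec f w := by
  funext k
  simp [Shape.mapVec]

theorem mapVec_smul {A' : Type*} [CommRing A'] (f : A →+* A') (a : MvPolynomial (Fin (n + 1)) A)
    (w : ι → MvPolynomial (Fin (n + 1)) A) :
    Shape.mapVec f (a • w) = MvPolynomial.map f a • Shape.mapVec f w := by
  funext k
  simp [Shape.mapVec]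

end SuppIn

/-! ### Cones and sous-escaliers of the syzygy shapes -/

namespace Shape

variable {n : ℕ} (X : Shape n) {A : Type*} [CommRing A]

/-- The pairs `(γ, η)` such that all the variables of `x^η` are multiplicative for `head γ`. -/
def mult : Set (X.P × Mon n) := {σ | ∀ j ∈ σ.2.support, j ≤ minVar (X.exp σ.1)}

/-- A term `x^η f_γ` avoids every `x_i f_γ` with `x_i` non-multiplicative exactly when all variables
of `x^η` are multiplicative. This identifies cofactors at one level with normal forms at the next.
-/
theorem next_escalier : X.next.escalier = X.mult := by
  ext σ
  constructor
  · intro h j hj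
    by_contra hlt
    refine h ⟨σ.1, j, not_le.1 hlt⟩ rfl ?_
    exact Finsupp.single_le_iff.2 (Nat.one_le_iff_ne_zero.2 (Finsupp.mem_support_iff.1 hj))
  · intro h ρ hρ hle
    have h1 : 1 ≤ σ.2 ρ.2.1 := Finsupp.single_le_iff.1 hle
    have h2 := h ρ.2.1 (Finsupp.mem_support_iff.2 (by omega))
    have h3 : ρ.1 = σ.1 := hρ
    exact absurd (h3 ▸ ρ.2.2) (not_lt.2 h2)

theorem inCone_iff {τ : X.P} {σ : X.Term} :
    InCone (X.head τ) σ ↔ σ.1 = X.comp τ ∧ ∃ δ, (τ, δ) ∈ X.mult ∧ σ.2 = δ + X.exp τ := Iff.rfl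

theorem coneSupported_iff {Q : X.P → MvPolynomial (Fin (n + 1)) A} :
    X.ConeSupported Q ↔ Q ∈ suppIn A X.mult := by
  constructor
  · intro h γ η hne
    obtain ⟨-, δ, hδ, h2⟩ := h γ η (MvPolynomial.mem_support_iff.2 hne)
    have h3 : η = δ := add_right_cancel h2
    exact h3 ▸ hδ
  · intro h γ η hη
    exact ⟨rfl, η, h γ η (MvPolynomial.mem_support_iff.1 hη), rfl⟩

theorem escSpan_eq : X.escSpan A = suppIn A X.escalier := span_term_image _

theorem escSpanDeg_eq (s : ℤ) :
    X.escSpanDeg A s = suppIn A {σ | σ ∈ X.escalier ∧ X.deg σ = s} := span_term_image _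

theorem degPart_eq (s : ℤ) : X.degPart A s = suppIn A {σ | X.deg σ = s} := by
  ext f
  exact ⟨fun h k η hne => h (k, η) hne, fun h σ hne => h σ.1 σ.2 hne⟩

theorem deg_add (k : X.ι) (δ η : Mon n) : X.deg (k, δ + η) = δ.degree + X.deg (k, η) := by
  simp [deg, add_assoc]

theorem next_deg (σ : X.next.Term) : X.next.deg σ = σ.2.degree + X.deg (X.head σ.1) := rfl

theorem next_deg_eq (γ : X.P) (η : Mon n) :
    X.next.deg (γ, η) = X.deg (X.comp γ, η + X.exp γ) := by
  rw [deg_add]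
  rfl

/-- The terms outside the sous-escalier are the disjoint union of the Pommaret cones. -/
structure IsPommaret : Prop where
  exists_inCone : ∀ σ : X.Term, σ ∉ X.escalier → ∃ τ : X.P, InCone (X.head τ) σ
  unique : ∀ (τ τ' : X.P) (σ : X.Term), InCone (X.head τ) σ → InCone (X.head τ') σ → τ = τ'

variable {X}

theorem not_mem_escalier_of_inCone {τ : X.P} {σ : X.Term} (h : InCone (X.head τ) σ) :
    σ ∉ X.escalier := by
  obtain ⟨h1, δ, -, h2⟩ := X.inCone_iff.1 h
  exact fun hσ => hσ τ h1.symm (h2 ▸ le_add_self)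

theorem head_not_mem_escalier (τ : X.P) : X.head τ ∉ X.escalier := fun h => h τ rfl le_rfl

theorem zero_mem_mult (τ : X.P) : (τ, (0 : Mon n)) ∈ X.mult := by
  intro j hj
  simp at hj

/-- The cone containing `x^η f_γ` is that of `x_i f_γ` for `x_i` the largest variable of `x^η`,
since `minVar` of the exponent of `x_i` is `i`. The original shape need not be Pommaret. -/
theorem isPommaret_next (X : Shape n) : X.next.IsPommaret := by
  constructor
  · rintro ⟨γ, η⟩ hσ
    rw [next_escalier] at hσ
    have h1 : ∃ j ∈ η.support, minVar (X.exp γ) < j := by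
      by_contra! h
      exact hσ h
    obtain ⟨j, hj, hlt⟩ := h1
    have hne : η.support.Nonempty := ⟨j, hj⟩
    set i := η.support.max' hne
    have hji : j ≤ i := Finset.le_max' _ _ hj
    have hmem : i ∈ η.support := Finset.max'_mem _ _
    refine ⟨⟨γ, i, hlt.trans_le hji⟩, rfl, η - Finsupp.single i 1, ?_, ?_⟩
    · intro k hk
      have h2 : k ∈ η.support := Finsupp.support_tsub hk
      have h3 : minVar (Finsupp.single i 1 : Mon n) = i := by
        simp [minVar]
      change k ≤ minVar (Finsupp.single i 1 : Mon n)
      rw [h3]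
      exact Finset.le_max' _ _ h2
    · exact (tsub_add_cancel_of_le (Finsupp.single_le_iff.2
        (Nat.one_le_iff_ne_zero.2 (Finsupp.mem_support_iff.1 hmem)))).symm
  · have key : ∀ (ρ ρ' : X.next.P) (σ : X.next.Term), InCone (X.next.head ρ) σ →
        InCone (X.next.head ρ') σ → ρ.2.1 ≤ ρ'.2.1 := by
      intro ρ ρ' σ h h'
      obtain ⟨-, δ, -, h2⟩ := h
      obtain ⟨-, δ', hδ', h2'⟩ := h'
      by_contra hlt
      have h3 : minVar (X.next.head ρ').2 = ρ'.2.1 := by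
        change minVar (Finsupp.single ρ'.2.1 1 : Mon n) = _
        simp [minVar]
      -- If `x_i` exceeded the variable of `ρ'`, it would not divide the cofactor `x^δ'`. Then `x_i`
      -- divides one expression of the term and not the other.
      have h4 : δ' ρ.2.1 = 0 := by
        by_contra hne
        exact hlt (h3 ▸ hδ' _ (Finsupp.mem_support_iff.2 hne))
      have h5 := DFunLike.congr_fun (h2.symm.trans h2') ρ.2.1
      change (δ + Finsupp.single ρ.2.1 1 : Mon n) ρ.2.1 = (δ' + Finsupp.single ρ'.2.1 1 : Mon n) ρ.2.1
        at h5
      rw [Finsupp.add_apply, Finsupp.add_apply, h4, Finsupp.single_eq_same,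
        Finsupp.single_eq_of_ne fun h => hlt h.le] at h5
      omega
    rintro ⟨γ, i, hi⟩ ⟨γ', i', hi'⟩ σ h h'
    have h1 : γ = γ' := h.1.symm.trans h'.1
    have h2 : i = i' := le_antisymm (key _ _ σ h h') (key _ _ σ h' h)
    subst h1 h2
    rfl

theorem IsPommaret.iter (hX : X.IsPommaret) : ∀ t, (X.iter t).IsPommaret
  | 0 => hX
  | t + 1 => isPommaret_next (X.iter t)

/-- The other alternative of `clx_lt_or_exists_add` would make `x^σ` a multiple of `x^γ`. This is
what makes reduction of tails terminate. -/
theorem clx_lt_of_mem_escalier {δ δ' σ : Mon n} {γ : X.P} (hσ : (X.comp γ, σ) ∈ X.escalier)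
    (hγ : (γ, δ') ∈ X.mult) (h : δ + σ = δ' + X.exp γ) : clx δ' < clx δ := by
  rcases clx_lt_or_exists_add h hγ with h1 | ⟨ε, h1, -⟩
  · exact h1
  · exact absurd (h1 ▸ le_add_self) (hσ γ rfl)

/-- Otherwise the head of `τ` would lie in the cone of `γ`; disjointness of cones gives `τ = γ`,
hence `δ = δ'`, which is multiplicative. This handles the head of `x_i F_τ`, as the previous lemma
handles its tail. -/
theorem IsPommaret.clx_lt_of_not_mem_mult (hX : X.IsPommaret) {δ δ' : Mon n} {τ γ : X.P}
    (hτ : (τ, δ) ∉ X.mult) (hγ : (γ, δ') ∈ X.mult) (hc : X.comp τ = X.comp γ)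
    (h : δ + X.exp τ = δ' + X.exp γ) : clx δ' < clx δ := by
  rcases clx_lt_or_exists_add h hγ with h1 | ⟨ε, h1, h2⟩
  · exact h1
  · exfalso
    have hε : (γ, ε) ∈ X.mult := fun j hj => hγ j (by
      rw [Finsupp.mem_support_iff] at hj ⊢
      change ε j ≠ 0 at hj
      change δ' j ≠ 0
      rw [h2, Finsupp.add_apply]
      omega)
    have h3 : τ = γ := hX.unique τ γ (X.head τ) ⟨rfl, 0, zero_mem_mult τ, (zero_add _).symm⟩
      ⟨hc, ε, hε, h1⟩
    subst h3
    have h4 : ε = 0 := by simpa using h1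
    rw [h4, add_zero] at h2
    exact hτ (h2 ▸ hγ)

/-! ### Existence and uniqueness of normal forms -/

theorem IsMarkedSet.tail_mem {F : Matrix X.ι X.P (MvPolynomial (Fin (n + 1)) A)}
    (hF : X.IsMarkedSet F) (τ : X.P) :
    F.col τ - term A (X.head τ) ∈
      suppIn A {σ | σ ∈ X.escalier ∧ X.deg σ = X.deg (X.head τ)} := by
  classical
  intro k η hne
  rw [Pi.sub_apply, MvPolynomial.coeff_sub, coeff_term] at hne
  by_cases h : (k, η) = X.head τ
  · obtain ⟨rfl, rfl⟩ := Prod.mk.inj h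
    exact absurd (by simp [hF.coeff_head τ, h]) hne
  · rw [if_neg h, sub_zero] at hne
    exact ⟨(hF.supp τ (k, η) hne).resolve_left h, hF.homog τ (k, η) hne⟩

/-- The elements with a normal form with respect to `F`, homogeneous of degree `s` and with
cofactors in `B`. -/
def reducible (F : Matrix X.ι X.P (MvPolynomial (Fin (n + 1)) A)) (s : ℤ) (B : Set (Mon n)) :
    Submodule A (X.Free A) :=
  (suppIn A {σ : X.P × Mon n | σ ∈ X.mult ∧ X.next.deg σ = s ∧ σ.2 ∈ B}).map
      (F.mulVecLin.restrictScalars A) ⊔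
    suppIn A {σ | σ ∈ X.escalier ∧ X.deg σ = s}

theorem mem_reducible {F : Matrix X.ι X.P (MvPolynomial (Fin (n + 1)) A)} {s : ℤ}
    {B : Set (Mon n)} {f : X.Free A} :
    f ∈ reducible F s B ↔
      ∃ Q ∈ suppIn A {σ : X.P × Mon n | σ ∈ X.mult ∧ X.next.deg σ = s ∧ σ.2 ∈ B},
        ∃ g ∈ suppIn A {σ | σ ∈ X.escalier ∧ X.deg σ = s}, F.mulVec Q + g = f := by
  simp [reducible, Submodule.mem_sup]

theorem reducible_mono (F : Matrix X.ι X.P (MvPolynomial (Fin (n + 1)) A)) (s : ℤ)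
    {B B' : Set (Mon n)} (h : B ⊆ B') : reducible F s B ≤ reducible F s B' :=
  sup_le_sup_right (Submodule.map_mono (suppIn_mono (by
    rintro _ ⟨h1, h2, h3⟩
    exact ⟨h1, h2, h h3⟩))) _

section Marked

variable {F : Matrix X.ι X.P (MvPolynomial (Fin (n + 1)) A)}

/-- Subtract `x^δ F_τ`: each term of `x^δ` times the tail either is in the sous-escalier or lies in
a cone with strictly smaller cofactor, so induction applies. The bound on cofactors is recorded
because slicing depends on it. -/
theorem term_mem_reducible (hX : X.IsPommaret) (hF : X.IsMarkedSet F) (δ : Mon n) :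
    ∀ τ : X.P, (τ, δ) ∈ X.mult → term A (X.comp τ, δ + X.exp τ) ∈
      reducible F (X.deg (X.comp τ, δ + X.exp τ)) {η | clx η ≤ clx δ} := by
  induction δ using clx_wellFounded.induction with
  | _ δ ih =>
  intro τ hτ
  set s := X.deg (X.comp τ, δ + X.exp τ) with hs
  have h1 : F.mulVec (term A (τ, δ)) ∈ reducible F s {η | clx η ≤ clx δ} :=
    mem_reducible.2 ⟨_, term_mem_suppIn ⟨hτ, X.next_deg_eq τ δ, le_refl (clx δ)⟩, 0,
      Submodule.zero_mem _, add_zero _⟩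
  have h2 : MvPolynomial.monomial δ (1 : A) • (F.col τ - term A (X.head τ)) ∈
      reducible F s {η | clx η ≤ clx δ} := by
    refine suppIn_le ?_ (monomial_smul_mem_suppIn (hF.tail_mem τ) δ 1)
    rintro _ ⟨⟨k, σ⟩, ⟨hσ, hdeg⟩, rfl⟩
    have hs' : X.deg (k, δ + σ) = s := by
      rw [hs, deg_add, deg_add, hdeg]
      rfl
    by_cases hesc : (k, δ + σ) ∈ X.escalier
    · exact Submodule.mem_sup_right (term_mem_suppIn ⟨hesc, hs'⟩)
    · obtain ⟨γ, hγ⟩ := hX.exists_inCone _ hesc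
      obtain ⟨hk, δ', hδ', h3⟩ := X.inCone_iff.1 hγ
      change k = X.comp γ at hk
      change δ + σ = δ' + X.exp γ at h3
      subst hk
      have hlt := clx_lt_of_mem_escalier hσ hδ' h3
      have h4 := ih δ' hlt γ hδ'
      rw [← h3, hs'] at h4
      exact reducible_mono F s (fun η hη => le_trans hη hlt.le) h4
  have h5 := Submodule.sub_mem _ h1 h2
  rw [mulVec_term, smul_sub, monomial_smul_term, sub_sub_cancel] at h5
  exact h5

theorem degPart_le_reducible (hX : X.IsPommaret) (hF : X.IsMarkedSet F) (s : ℤ) :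
    suppIn A {σ | X.deg σ = s} ≤ reducible F s Set.univ := by
  refine suppIn_le ?_
  rintro ⟨k, η⟩ hσ
  by_cases hesc : (k, η) ∈ X.escalier
  · exact Submodule.mem_sup_right (term_mem_suppIn ⟨hesc, hσ⟩)
  · obtain ⟨γ, hγ⟩ := hX.exists_inCone _ hesc
    obtain ⟨hk, δ, hδ, h3⟩ := X.inCone_iff.1 hγ
    change k = X.comp γ at hk
    change η = δ + X.exp γ at h3
    subst hk h3
    have h4 := term_mem_reducible hX hF δ γ hδ
    rw [show X.deg (X.comp γ, δ + X.exp γ) = s from hσ] at h4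
    exact reducible_mono F s (Set.subset_univ _) h4

theorem single_not_mem_mult {τ : X.P} {i : Fin (n + 1)} (hi : minVar (X.exp τ) < i) :
    (τ, Finsupp.single i 1) ∉ X.mult := fun h =>
  absurd hi (not_lt.2 (h i (by simp)))

/-- Neither the head nor the tail of `F_τ`, multiplied by `x_i`, can be in a cone with cofactor
`x_i` or larger. The strict bound forces all variables of the cofactors below `x_i`, by
`lt_of_clx_lt_single`. -/
theorem X_smul_col_mem_reducible (hX : X.IsPommaret) (hF : X.IsMarkedSet F) {τ : X.P}
    {i : Fin (n + 1)} (hi : minVar (X.exp τ) < i) :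
    (MvPolynomial.X i : MvPolynomial (Fin (n + 1)) A) • F.col τ ∈
      reducible F (X.next.deg (τ, Finsupp.single i 1))
        {η | clx η < clx (Finsupp.single i 1)} := by
  have h0 : F.col τ ∈ suppIn A {σ | (σ = X.head τ ∨ σ ∈ X.escalier) ∧
      X.deg σ = X.deg (X.head τ)} := fun k η hne =>
    ⟨hF.supp τ (k, η) hne, hF.homog τ (k, η) hne⟩
  refine suppIn_le ?_ (monomial_smul_mem_suppIn h0 (Finsupp.single i 1) 1)
  rintro _ ⟨⟨k, σ⟩, ⟨hσ, hdeg⟩, rfl⟩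
  have hs : X.deg (k, Finsupp.single i 1 + σ) = X.next.deg (τ, Finsupp.single i 1) := by
    rw [next_deg, deg_add, hdeg]
  by_cases hesc : (k, Finsupp.single i 1 + σ) ∈ X.escalier
  · exact Submodule.mem_sup_right (term_mem_suppIn ⟨hesc, hs⟩)
  · obtain ⟨γ, hγ⟩ := hX.exists_inCone _ hesc
    obtain ⟨hk, δ', hδ', h3⟩ := X.inCone_iff.1 hγ
    change k = X.comp γ at hk
    change Finsupp.single i 1 + σ = δ' + X.exp γ at h3
    subst hk
    have hlt : clx δ' < clx (Finsupp.single i 1) := by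
      rcases hσ with hσ | hσ
      · obtain ⟨h4, rfl⟩ := Prod.mk.inj hσ
        exact hX.clx_lt_of_not_mem_mult (single_not_mem_mult hi) hδ' h4.symm h3
      · exact clx_lt_of_mem_escalier hσ hδ' h3
    have h4 := term_mem_reducible hX hF δ' γ hδ'
    rw [← h3, hs] at h4
    exact reducible_mono F _ (fun η hη => lt_of_le_of_lt hη hlt) h4

/-- Another head contributing to this term would put it in two cones, or give it two cofactors in
one cone. A contributing tail would need a cofactor larger than the maximal `δ₀`. -/
theorem coeff_mulVec_of_max (hX : X.IsPommaret) (hF : X.IsMarkedSet F)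
    {Q : X.P → MvPolynomial (Fin (n + 1)) A} (hQ : Q ∈ suppIn A X.mult) {γ₀ : X.P} {δ₀ : Mon n}
    (h₀ : (γ₀, δ₀) ∈ X.mult) (hmax : ∀ γ b, (Q γ).coeff b ≠ 0 → clx b ≤ clx δ₀) :
    (F.mulVec Q (X.comp γ₀)).coeff (δ₀ + X.exp γ₀) = (Q γ₀).coeff δ₀ := by
  classical
  have key : ∀ γ a b, b + a = δ₀ + X.exp γ₀ → (F (X.comp γ₀) γ).coeff a * (Q γ).coeff b ≠ 0 →
      γ = γ₀ ∧ b = δ₀ := by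
    intro γ a b hab hne
    have hb : (γ, b) ∈ X.mult := hQ γ b (right_ne_zero_of_mul hne)
    rcases hF.supp γ (X.comp γ₀, a) (left_ne_zero_of_mul hne) with h | h
    · obtain ⟨hc, rfl⟩ := Prod.mk.inj h
      have h1 : γ = γ₀ := hX.unique γ γ₀ (X.comp γ₀, b + X.exp γ) ⟨hc, b, hb, rfl⟩
        ⟨rfl, δ₀, h₀, hab⟩
      subst h1
      exact ⟨rfl, add_right_cancel hab⟩
    · exact absurd (clx_lt_of_mem_escalier h h₀ hab)
        (not_lt.2 (hmax γ b (right_ne_zero_of_mul hne)))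
  rw [Matrix.mulVec, dotProduct, MvPolynomial.coeff_sum, Finset.sum_eq_single γ₀,
    MvPolynomial.coeff_mul, Finset.sum_eq_single (X.exp γ₀, δ₀)]
  · rw [hF.coeff_head, one_mul]
  · rintro ⟨a, b⟩ hab hne
    rw [Finset.HasAntidiagonal.mem_antidiagonal] at hab
    by_contra h
    obtain ⟨-, rfl⟩ := key γ₀ a b (by rw [← hab, add_comm]) h
    exact hne (by rw [Prod.mk.injEq]; exact ⟨add_right_cancel (hab.trans (add_comm _ _)), rfl⟩)
  · intro h
    exact absurd (Finset.HasAntidiagonal.mem_antidiagonal.2 (add_comm _ _)) h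
  · intro γ _ hne
    rw [MvPolynomial.coeff_mul]
    refine Finset.sum_eq_zero ?_
    rintro ⟨a, b⟩ hab
    rw [Finset.HasAntidiagonal.mem_antidiagonal] at hab
    by_contra h
    exact hne (key γ a b (by rw [← hab, add_comm]) h).1
  · intro h
    exact absurd (Finset.mem_univ _) h

/-- A maximal cofactor of a nonzero `Q` leaves a nonzero coefficient at a term of a cone, where `g`
has none. -/
theorem eq_zero_of_mulVec_add_eq_zero (hX : X.IsPommaret) (hF : X.IsMarkedSet F)
    {Q : X.P → MvPolynomial (Fin (n + 1)) A} {g : X.Free A} (hQ : Q ∈ suppIn A X.mult)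
    (hg : g ∈ suppIn A X.escalier) (h : F.mulVec Q + g = 0) : Q = 0 := by
  classical
  by_contra hne
  have h1 : (Finset.univ.biUnion fun γ => (Q γ).support).Nonempty := by
    by_contra h2
    rw [Finset.not_nonempty_iff_eq_empty] at h2
    refine hne (funext fun γ => ?_)
    have h3 : (Q γ).support ⊆ ∅ :=
      h2 ▸ Finset.subset_biUnion_of_mem (fun γ => (Q γ).support) (Finset.mem_univ γ)
    exact MvPolynomial.support_eq_empty.1 (Finset.subset_empty.1 h3)
  obtain ⟨δ₀, hδ₀, hmax⟩ := Finset.exists_max_image _ clx h1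
  simp only [Finset.mem_biUnion, Finset.mem_univ, true_and, MvPolynomial.mem_support_iff] at hδ₀
  obtain ⟨γ₀, hγ₀⟩ := hδ₀
  have h₀ : (γ₀, δ₀) ∈ X.mult := hQ γ₀ δ₀ hγ₀
  have h2 := coeff_mulVec_of_max hX hF hQ h₀ fun γ b hb => hmax b
    (Finset.mem_biUnion.2 ⟨γ, Finset.mem_univ γ, MvPolynomial.mem_support_iff.2 hb⟩)
  have h3 : (g (X.comp γ₀)).coeff (δ₀ + X.exp γ₀) = 0 := by
    by_contra h4
    exact not_mem_escalier_of_inCone (X.inCone_iff.2 ⟨rfl, δ₀, h₀, rfl⟩) (hg _ _ h4)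
  have h4 := congrArg (MvPolynomial.coeff (δ₀ + X.exp γ₀)) (congrFun h (X.comp γ₀))
  rw [Pi.add_apply, MvPolynomial.coeff_add, h2, h3, add_zero] at h4
  exact hγ₀ (by simpa using h4)

theorem normalForm_unique (hX : X.IsPommaret) (hF : X.IsMarkedSet F)
    {Q Q' : X.P → MvPolynomial (Fin (n + 1)) A} {g g' : X.Free A} (hQ : Q ∈ suppIn A X.mult)
    (hQ' : Q' ∈ suppIn A X.mult) (hg : g ∈ suppIn A X.escalier) (hg' : g' ∈ suppIn A X.escalier)
    (h : F.mulVec Q + g = F.mulVec Q' + g') : Q = Q' ∧ g = g' := by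
  have h1 : Q - Q' = 0 := by
    refine eq_zero_of_mulVec_add_eq_zero hX hF (Submodule.sub_mem _ hQ hQ')
      (Submodule.sub_mem _ hg hg') ?_
    rw [Matrix.mulVec_sub, sub_add_sub_comm, h, sub_self]
  have h2 := sub_eq_zero.1 h1
  subst h2
  exact ⟨rfl, add_left_cancel h⟩

end Marked

end Shape

/-! ### Fundamental syzygies, marked bases and syzygy modules -/

namespace Shape

variable {n : ℕ} {X : Shape n} {A : Type*} [CommRing A]
  {F : Matrix X.ι X.P (MvPolynomial (Fin (n + 1)) A)}

/-- By uniqueness `Q` is the cofactor vector produced by the division of `x_i F_τ`, so it inherits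
the degree and the strict bound. -/
theorem cofactor_mem (hX : X.IsPommaret) (hF : X.IsMarkedSet F) {τ : X.P} {i : Fin (n + 1)}
    (hi : minVar (X.exp τ) < i) {Q : X.P → MvPolynomial (Fin (n + 1)) A}
    (hQ : Q ∈ suppIn A X.mult)
    (h : (MvPolynomial.X i : MvPolynomial (Fin (n + 1)) A) • F.col τ = F.mulVec Q) :
    Q ∈ suppIn A {σ : X.P × Mon n | σ ∈ X.mult ∧
      X.next.deg σ = X.next.deg (τ, Finsupp.single i 1) ∧
      σ.2 ∈ {η | clx η < clx (Finsupp.single i 1)}} := by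
  obtain ⟨Q', hQ', g, hg, h1⟩ := mem_reducible.1 (X_smul_col_mem_reducible hX hF hi)
  rw [h, ← add_zero (F.mulVec Q)] at h1
  have h2 := (normalForm_unique hX hF (suppIn_mono (fun _ hσ => hσ.1) hQ') hQ
    (suppIn_mono (fun _ hσ => hσ.1) hg) (Submodule.zero_mem _) h1).1
  exact h2 ▸ hQ'

theorem mulVec_term_next_head (ρ : X.next.P) :
    F.mulVec (term A (X.next.head ρ)) =
      (MvPolynomial.X ρ.2.1 : MvPolynomial (Fin (n + 1)) A) • F.col ρ.1 :=
  mulVec_term F (X.next.head ρ)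

/-- Separates a matrix equation from a support condition; the equation alone survives as the
defining equations of the scheme. -/
theorem isFundSyz_iff {G : Matrix X.next.ι X.next.P (MvPolynomial (Fin (n + 1)) A)} :
    X.IsFundSyz F G ↔ ∀ ρ : X.next.P, F.mulVec (G.col ρ) = 0 ∧
      term A (X.next.head ρ) - G.col ρ ∈ suppIn A X.mult := by
  constructor
  · intro h ρ
    obtain ⟨(Q : X.next.ι → MvPolynomial (Fin (n + 1)) A), hQ, h1, h2⟩ := h ρ
    have h3 : G.col ρ = term A (X.next.head ρ) - Q := funext h2
    constructor
    · refine (congrArg F.mulVec h3).trans ?_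
      refine (Matrix.mulVec_sub F _ _).trans ?_
      exact sub_eq_zero.2 ((mulVec_term_next_head ρ).trans h1)
    · rw [h3, sub_sub_cancel]
      exact X.coneSupported_iff.1 hQ
  · intro h ρ
    obtain ⟨h1, h2⟩ := h ρ
    refine ⟨_, X.coneSupported_iff.2 h2, ?_, fun γ => ?_⟩
    · refine Eq.symm ((Matrix.mulVec_sub F _ _).trans ?_)
      exact (congrArg₂ (· - ·) (mulVec_term_next_head ρ) h1).trans (sub_zero _)
    · exact (sub_sub_cancel _ _).symm

theorem isFundSyz_unique (hX : X.IsPommaret) (hF : X.IsMarkedSet F)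
    {G G' : Matrix X.next.ι X.next.P (MvPolynomial (Fin (n + 1)) A)} (hG : X.IsFundSyz F G)
    (hG' : X.IsFundSyz F G') : G = G' := by
  ext1 γ ρ
  obtain ⟨Q, hQ, h1, h2⟩ := hG ρ
  obtain ⟨Q', hQ', h1', h2'⟩ := hG' ρ
  have h3 := (normalForm_unique (g := 0) (g' := 0) hX hF (X.coneSupported_iff.1 hQ)
    (X.coneSupported_iff.1 hQ') (Submodule.zero_mem _) (Submodule.zero_mem _)
    (by rw [← h1, ← h1'])).1
  exact (h2 γ).trans (h3 ▸ (h2' γ).symm)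

theorem isFundSyz_supp (hX : X.IsPommaret) (hF : X.IsMarkedSet F)
    {G : Matrix X.next.ι X.next.P (MvPolynomial (Fin (n + 1)) A)} (hG : X.IsFundSyz F G)
    (ρ : X.next.P) : term A (X.next.head ρ) - G.col ρ ∈ suppIn A {σ : X.next.Term |
      X.Sliced ρ σ ∧ σ ∈ X.next.escalier ∧ X.next.deg σ = X.next.deg (X.next.head ρ)} := by
  obtain ⟨(Q : X.next.ι → MvPolynomial (Fin (n + 1)) A), hQ, h1, h2⟩ := hG ρ
  have h3 : G.col ρ = term A (X.next.head ρ) - Q := funext h2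
  rw [h3, sub_sub_cancel]
  refine suppIn_mono ?_ (cofactor_mem hX hF ρ.2.2 (X.coneSupported_iff.1 hQ) h1)
  rintro σ ⟨hσ, hdeg, hlt⟩
  exact ⟨fun j hj => ⟨lt_of_clx_lt_single hlt j hj, hσ j hj⟩, X.next_escalier ▸ hσ, hdeg⟩

theorem isMarkedSet_of_tail {G : Matrix X.ι X.P (MvPolynomial (Fin (n + 1)) A)}
    (hG : ∀ ρ : X.P, term A (X.head ρ) - G.col ρ ∈
      suppIn A {σ | σ ∈ X.escalier ∧ X.deg σ = X.deg (X.head ρ)}) : X.IsMarkedSet G := by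
  classical
  have key : ∀ (ρ : X.P) (k : X.ι) (η : Mon n), (k, η) ≠ X.head ρ →
      (G k ρ).coeff η ≠ 0 → (k, η) ∈ X.escalier ∧ X.deg (k, η) = X.deg (X.head ρ) := by
    intro ρ k η h1 h2
    refine hG ρ k η ?_
    rw [Pi.sub_apply, MvPolynomial.coeff_sub, coeff_term, if_neg h1, zero_sub, neg_ne_zero]
    exact h2
  refine ⟨fun τ σ hσ => ?_, fun τ => ?_, fun τ σ hσ => ?_⟩
  · by_cases h : (σ.1, σ.2) = X.head τ
    · rw [← h]
    · exact (key τ σ.1 σ.2 h hσ).2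
  · by_contra h
    refine head_not_mem_escalier τ (hG τ (X.comp τ) (X.exp τ) ?_).1
    rw [Pi.sub_apply, MvPolynomial.coeff_sub, coeff_term, sub_ne_zero]
    exact fun h1 => h (h1.symm.trans (if_pos rfl))
  · by_cases h : (σ.1, σ.2) = X.head τ
    · exact Or.inl h
    · exact Or.inr (key τ σ.1 σ.2 h hσ).1

theorem IsFundSyz.isMarkedSet (hX : X.IsPommaret) (hF : X.IsMarkedSet F)
    {G : Matrix X.next.ι X.next.P (MvPolynomial (Fin (n + 1)) A)} (hG : X.IsFundSyz F G) :
    X.next.IsMarkedSet G :=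
  isMarkedSet_of_tail fun ρ => suppIn_mono (fun _ h => h.2) (isFundSyz_supp hX hF hG ρ)

theorem mem_colSpan_iff {f : X.Free A} : f ∈ X.colSpan F ↔ ∃ Q, F.mulVec Q = f := by
  rw [colSpan, ← Matrix.range_mulVecLin]
  rfl

/-- A Buchberger-type criterion. If `x^η` has a non-multiplicative variable `x_i`, rewriting `x_i
F_τ` by its fundamental syzygy turns `x^η F_τ` into a combination of `x^{η'} F_γ` with `η'` smaller
than `η`. -/
theorem monomial_smul_col_mem (hX : X.IsPommaret) (hF : X.IsMarkedSet F)
    {G : Matrix X.next.ι X.next.P (MvPolynomial (Fin (n + 1)) A)} (hG : X.IsFundSyz F G)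
    (η : Mon n) : ∀ τ : X.P, MvPolynomial.monomial η (1 : A) • F.col τ ∈
      (suppIn A X.mult).map (F.mulVecLin.restrictScalars A) := by
  induction η using clx_wellFounded.induction with
  | _ η ih =>
  intro τ
  by_cases hτ : (τ, η) ∈ X.mult
  · exact ⟨term A (τ, η), term_mem_suppIn hτ, mulVec_term F (τ, η)⟩
  · have h1 : ∃ i ∈ η.support, minVar (X.exp τ) < i := by
      by_contra! h
      exact hτ h
    obtain ⟨i, hi, hlt⟩ := h1
    obtain ⟨Q, hQ, h2, -⟩ := hG ⟨τ, i, hlt⟩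
    change (MvPolynomial.X i : MvPolynomial (Fin (n + 1)) A) • F.col τ = F.mulVec Q at h2
    have hQ' := cofactor_mem hX hF hlt (X.coneSupported_iff.1 hQ) h2
    have hle : Finsupp.single i 1 ≤ η :=
      Finsupp.single_le_iff.2 (Nat.one_le_iff_ne_zero.2 (Finsupp.mem_support_iff.1 hi))
    have h3 : MvPolynomial.monomial η (1 : A) • F.col τ =
        F.mulVec (MvPolynomial.monomial (η - Finsupp.single i 1) (1 : A) • Q) := by
      rw [Matrix.mulVec_smul, ← h2, smul_smul, MvPolynomial.X, MvPolynomial.monomial_mul, one_mul,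
        tsub_add_cancel_of_le hle]
    rw [h3]
    have h4 : suppIn A ((fun σ : X.P × Mon n => (σ.1, (η - Finsupp.single i 1) + σ.2)) ''
        {σ : X.P × Mon n | σ ∈ X.mult ∧
          X.next.deg σ = X.next.deg (τ, Finsupp.single i 1) ∧
          σ.2 ∈ {η | clx η < clx (Finsupp.single i 1)}}) ≤
        ((suppIn A X.mult).map (F.mulVecLin.restrictScalars A)).comap
          (F.mulVecLin.restrictScalars A) := by
      refine suppIn_le ?_
      rintro _ ⟨⟨γ, δ⟩, ⟨-, -, hδ⟩, rfl⟩
      have h5 := clx_add_lt_clx_add (η - Finsupp.single i 1) hδ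
      rw [tsub_add_cancel_of_le hle] at h5
      have h6 := ih _ h5 γ
      rw [← mulVec_term F (γ, η - Finsupp.single i 1 + δ)] at h6
      exact h6
    exact h4 (monomial_smul_mem_suppIn hQ' _ _)

theorem exists_mult_of_mem_colSpan (hX : X.IsPommaret) (hF : X.IsMarkedSet F)
    {G : Matrix X.next.ι X.next.P (MvPolynomial (Fin (n + 1)) A)} (hG : X.IsFundSyz F G)
    {f : X.Free A} (hf : f ∈ X.colSpan F) : ∃ Q ∈ suppIn A X.mult, F.mulVec Q = f := by
  obtain ⟨Q, rfl⟩ := mem_colSpan_iff.1 hf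
  have h1 : suppIn A (Set.univ : Set (X.P × Mon n)) ≤
      ((suppIn A X.mult).map (F.mulVecLin.restrictScalars A)).comap
        (F.mulVecLin.restrictScalars A) := by
    refine suppIn_le fun σ _ => ?_
    have h2 := monomial_smul_col_mem hX hF hG σ.2 σ.1
    rw [← mulVec_term F σ] at h2
    exact h2
  exact h1 (mem_suppIn_univ Q)

theorem isFundSyz_of_forall_mem {W : Set (X.Free A)}
    (hW : ∀ f ∈ W, ∃ Q ∈ suppIn A X.mult, F.mulVec Q = f)
    (h : ∀ (τ : X.P) (i : Fin (n + 1)), minVar (X.exp τ) < i →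
      (MvPolynomial.X i : MvPolynomial (Fin (n + 1)) A) • F.col τ ∈ W) :
    ∃ G, X.IsFundSyz F G := by
  choose Q hQ h1 using fun ρ : X.next.P => hW _ (h ρ.1 ρ.2.1 ρ.2.2)
  exact ⟨fun γ ρ => term A (X.next.head ρ) γ - Q ρ γ, fun ρ =>
    ⟨Q ρ, X.coneSupported_iff.2 (hQ ρ), (h1 ρ).symm, fun _ => rfl⟩⟩

theorem disjoint_colSpan (hX : X.IsPommaret) (hF : X.IsMarkedSet F)
    {G : Matrix X.next.ι X.next.P (MvPolynomial (Fin (n + 1)) A)} (hG : X.IsFundSyz F G) :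
    Disjoint ((X.colSpan F).restrictScalars A) (suppIn A X.escalier) := by
  rw [Submodule.disjoint_def]
  intro f hf hf'
  obtain ⟨Q, hQ, rfl⟩ := exists_mult_of_mem_colSpan hX hF hG hf
  have h := eq_zero_of_mulVec_add_eq_zero hX hF hQ (Submodule.neg_mem _ hf') (add_neg_cancel _)
  rw [h, Matrix.mulVec_zero]

/-- Division alone makes the two summands fill each degree; the fundamental syzygies are needed only
for the intersection to vanish. -/
theorem isMarkedBasis_of_isFundSyz (hX : X.IsPommaret) (hF : X.IsMarkedSet F)
    {G : Matrix X.next.ι X.next.P (MvPolynomial (Fin (n + 1)) A)} (hG : X.IsFundSyz F G) :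
    X.IsMarkedBasis F where
  toIsMarkedSet := hF
  disjoint s := by
    rw [escSpanDeg_eq]
    exact (disjoint_colSpan hX hF hG).mono inf_le_left (suppIn_mono fun _ h => h.1)
  sup_eq s := by
    rw [escSpanDeg_eq]
    have h0 : suppIn A {σ | σ ∈ X.escalier ∧ X.deg σ = s} ≤ X.degPart A s := by
      rw [degPart_eq]
      exact suppIn_mono fun _ h => h.2
    refine le_antisymm (sup_le inf_le_right h0) fun f hf => ?_
    have h1 := hf
    rw [degPart_eq] at h1
    obtain ⟨Q, -, g, hg, h2⟩ := mem_reducible.1 (degPart_le_reducible hX hF s h1)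
    rw [← h2]
    refine Submodule.add_mem_sup ⟨mem_colSpan_iff.2 ⟨Q, rfl⟩, ?_⟩ hg
    rw [← eq_sub_iff_add_eq] at h2
    rw [h2]
    exact Submodule.sub_mem _ hf (h0 hg)

/-- The normal form of `x_i F_τ` lies both in `(F)_s` and in `⟨N(U)_s⟩`, hence is zero. -/
theorem IsMarkedBasis.exists_isFundSyz (hX : X.IsPommaret) (hF : X.IsMarkedBasis F) :
    ∃ G, X.IsFundSyz F G := by
  refine isFundSyz_of_forall_mem (W := {f | ∃ Q ∈ suppIn A X.mult, F.mulVec Q = f})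
    (fun f hf => hf) fun τ i hi => ?_
  set s := X.next.deg (τ, Finsupp.single i 1)
  obtain ⟨Q, hQ, g, hg, h1⟩ :=
    mem_reducible.1 (X_smul_col_mem_reducible hX hF.toIsMarkedSet hi)
  refine ⟨Q, suppIn_mono (fun _ h => h.1) hQ, ?_⟩
  have h2 : g = (MvPolynomial.X i : MvPolynomial (Fin (n + 1)) A) • F.col τ - F.mulVec Q := by
    rw [← h1, add_sub_cancel_left]
  have h3 : g = 0 := by
    refine (Submodule.disjoint_def.1 (hF.disjoint s)) g (Submodule.mem_inf.2 ⟨?_, ?_⟩) ?_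
    · rw [h2]
      have h3 : F.col τ ∈ X.colSpan F := Submodule.subset_span ⟨τ, rfl⟩
      exact Submodule.sub_mem (X.colSpan F) (Submodule.smul_mem _ _ h3)
        (mem_colSpan_iff.2 ⟨Q, rfl⟩)
    · rw [degPart_eq]
      exact suppIn_mono (fun _ h => h.2) hg
    · rw [escSpanDeg_eq]
      exact hg
  rw [← h1, h3, add_zero]

theorem isMarkedModule_of_isFundSyz (hX : X.IsPommaret) (hF : X.IsMarkedSet F)
    {G : Matrix X.next.ι X.next.P (MvPolynomial (Fin (n + 1)) A)} (hG : X.IsFundSyz F G) :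
    X.IsMarkedModule (X.colSpan F) where
  graded := by
    refine le_antisymm (iSup_le fun s => inf_le_left) fun f hf => ?_
    obtain ⟨Q, rfl⟩ := mem_colSpan_iff.1 hf
    have h1 : suppIn A (Set.univ : Set (X.P × Mon n)) ≤
        (⨆ s : ℤ, (X.colSpan F).restrictScalars A ⊓ X.degPart A s).comap
          (F.mulVecLin.restrictScalars A) := by
      refine suppIn_le fun σ _ => ?_
      refine Submodule.mem_iSup_of_mem (X.next.deg σ) ⟨mem_colSpan_iff.2 ⟨_, rfl⟩, ?_⟩
      rw [degPart_eq]
      change F.mulVec (term A σ) ∈ _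
      rw [mulVec_term]
      have h2 : F.col σ.1 ∈ suppIn A {σ' | X.deg σ' = X.deg (X.head σ.1)} :=
        fun k η hne => hF.homog σ.1 (k, η) hne
      refine suppIn_mono ?_ (monomial_smul_mem_suppIn h2 σ.2 1)
      rintro _ ⟨⟨k, η⟩, h3, rfl⟩
      change X.deg (k, η) = _ at h3
      change X.deg (k, σ.2 + η) = _
      rw [deg_add, h3]
      rfl
    exact h1 (mem_suppIn_univ Q)
  isCompl := by
    rw [escSpan_eq]
    refine ⟨disjoint_colSpan hX hF hG, ?_⟩
    rw [codisjoint_iff_le_sup]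
    intro f _
    have h1 : suppIn A (Set.univ : Set X.Term) ≤
        (X.colSpan F).restrictScalars A ⊔ suppIn A X.escalier := by
      refine suppIn_le fun σ _ => ?_
      obtain ⟨Q, -, g, hg, h2⟩ := mem_reducible.1
        (degPart_le_reducible hX hF (X.deg σ) (term_mem_suppIn (A := A) (σ := σ) rfl))
      rw [← h2]
      exact Submodule.add_mem_sup (mem_colSpan_iff.2 ⟨Q, rfl⟩) (suppIn_mono (fun _ h => h.1) hg)
    exact h1 (mem_suppIn_univ f)

/-- Divide `f` by the marked set `G`: the normal form is supported on `X.mult`, and it is again a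
syzygy of `F`. Uniqueness of cone-supported writings for `F` makes it zero. -/
theorem exists_mult_of_mem_syz (hX : X.IsPommaret) (hF : X.IsMarkedSet F)
    {G : Matrix X.next.ι X.next.P (MvPolynomial (Fin (n + 1)) A)} (hG : X.IsFundSyz F G)
    {f : X.next.Free A} (hf : f ∈ X.syz F) : ∃ Q ∈ suppIn A X.next.mult, G.mulVec Q = f := by
  have hX' := isPommaret_next X
  have hG' := hG.isMarkedSet hX hF
  have h1 : suppIn A (Set.univ : Set X.next.Term) ≤
      (suppIn A X.next.mult).map (G.mulVecLin.restrictScalars A) ⊔ suppIn A X.mult := by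
    refine suppIn_le fun σ _ => ?_
    obtain ⟨Q, hQ, g, hg, h2⟩ := mem_reducible.1
      (degPart_le_reducible hX' hG' (X.next.deg σ) (term_mem_suppIn (A := A) (σ := σ) rfl))
    rw [← h2]
    refine Submodule.add_mem_sup ⟨Q, suppIn_mono (fun _ h => h.1) hQ, rfl⟩ ?_
    rw [← next_escalier]
    exact suppIn_mono (fun _ h => h.1) hg
  obtain ⟨_, ⟨Q, hQ, rfl⟩, g, hg, h2⟩ := Submodule.mem_sup.1 (h1 (mem_suppIn_univ f))
  refine ⟨Q, hQ, ?_⟩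
  have h3 : F.mulVec (G.mulVec Q) = 0 := by
    have h4 : G.mulVec Q ∈ X.next.colSpan G := mem_colSpan_iff.2 ⟨Q, rfl⟩
    have h5 : X.next.colSpan G ≤ X.syz F := by
      refine Submodule.span_le.2 ?_
      rintro _ ⟨ρ, rfl⟩
      exact (isFundSyz_iff.1 hG ρ).1
    exact h5 h4
  have h4 : F.mulVec g = 0 := by
    have h5 : F.mulVec (G.mulVec Q + g) = 0 := (congrArg F.mulVec h2).trans hf
    have h6 := Matrix.mulVec_add F (G.mulVec Q) g
    rw [← h6.symm.trans h5]
    rw [h3, zero_add]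
  have h5 := eq_zero_of_mulVec_add_eq_zero hX hF hg (Submodule.zero_mem _)
    ((add_zero _).trans h4)
  exact (add_zero _).symm.trans ((congrArg (G.mulVec Q + ·) h5).symm.trans h2)

theorem IsFundSyz.colSpan_eq_syz (hX : X.IsPommaret) (hF : X.IsMarkedSet F)
    {G : Matrix X.next.ι X.next.P (MvPolynomial (Fin (n + 1)) A)} (hG : X.IsFundSyz F G) :
    X.next.colSpan G = X.syz F := by
  apply le_antisymm
  · refine Submodule.span_le.2 ?_
    rintro _ ⟨ρ, rfl⟩
    exact (isFundSyz_iff.1 hG ρ).1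
  · intro f hf
    obtain ⟨Q, -, h⟩ := exists_mult_of_mem_syz hX hF hG hf
    exact mem_colSpan_iff.2 ⟨Q, h⟩

/-- Each `x_i G_ρ` is a syzygy of `F`, so it is a cone-supported combination of the columns of `G`.
No condition beyond level zero is ever required. -/
theorem IsFundSyz.exists_next (hX : X.IsPommaret) (hF : X.IsMarkedSet F)
    {G : Matrix X.next.ι X.next.P (MvPolynomial (Fin (n + 1)) A)} (hG : X.IsFundSyz F G) :
    ∃ H, X.next.IsFundSyz G H :=
  isFundSyz_of_forall_mem (fun _ hf => exists_mult_of_mem_syz hX hF hG hf) fun ρ _ _ =>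
    Submodule.smul_mem _ _ (isFundSyz_iff.1 hG ρ).1

/-- The heads cancel in the difference of corresponding columns, which then lies in the module and
in the span of the sous-escalier. -/
theorem eq_of_colSpan_eq (hX : X.IsPommaret) (hF : X.IsMarkedSet F)
    {F' : Matrix X.ι X.P (MvPolynomial (Fin (n + 1)) A)} (hF' : X.IsMarkedSet F')
    {G : Matrix X.next.ι X.next.P (MvPolynomial (Fin (n + 1)) A)} (hG : X.IsFundSyz F G)
    (h : X.colSpan F = X.colSpan F') : F = F' := by
  have key : ∀ τ, F.col τ - F'.col τ = 0 := by
    intro τ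
    refine Submodule.disjoint_def.1 (disjoint_colSpan hX hF hG) _ ?_ ?_
    · refine Submodule.sub_mem _ (Submodule.subset_span ⟨τ, rfl⟩) ?_
      change F'.col τ ∈ X.colSpan F
      rw [h]
      exact Submodule.subset_span ⟨τ, rfl⟩
    · have h1 := Submodule.sub_mem _ (hF.tail_mem τ) (hF'.tail_mem τ)
      rw [sub_sub_sub_cancel_right] at h1
      exact suppIn_mono (fun _ h => h.1) h1
  ext1 k τ
  exact sub_eq_zero.1 (congrFun (key τ) k)

end Shape

/-! ### Marked sets and fundamental syzygies as parameter values -/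

namespace Shape

variable {n : ℕ} {X : Shape n} {A : Type*} [CommRing A]

theorem coeff_mat (t : ℕ) (v : X.Par t → A) (ρ : (X.iter t).P) (k : (X.iter t).ι) (η : Mon n)
    [Decidable ((k, η) = (X.iter t).head ρ)] [Decidable (X.IsPar t ρ (k, η))] :
    (X.mat t v k ρ).coeff η = (if (k, η) = (X.iter t).head ρ then 1 else 0) -
      if h : X.IsPar t ρ (k, η) then v ⟨(ρ, (k, η)), h⟩ else 0 := by
  classical
  rw [mat, Matrix.of_apply, MvPolynomial.coeff_sub, coeff_term, MvPolynomial.coeff_sum]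
  congr 1
  have h1 : ∀ p : X.Par t, MvPolynomial.coeff η
      (open Classical in if p.1.1 = ρ then MvPolynomial.C (v p) * term A p.1.2 k else 0) =
      if p.1 = (ρ, (k, η)) then v p else 0 := by
    intro p
    obtain ⟨⟨ρ', σ⟩, hp⟩ := p
    by_cases hρ : ρ' = ρ
    · by_cases hσ : (k, η) = σ
      · simp [hρ, coeff_term, ← hσ]
      · simp [hρ, coeff_term, hσ, Ne.symm hσ]
    · simp [hρ]
  rw [Finset.sum_congr rfl fun p _ => h1 p]
  by_cases h : X.IsPar t ρ (k, η)
  · rw [dif_pos h, Finset.sum_eq_single ⟨(ρ, (k, η)), h⟩]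
    · simp
    · intro p _ hne
      rw [if_neg fun h2 => hne (Subtype.ext h2)]
    · exact fun h2 => absurd (Finset.mem_univ _) h2
  · rw [dif_neg h]
    refine Finset.sum_eq_zero fun p _ => if_neg fun h2 => h ?_
    have h3 := p.2
    rwa [h2] at h3

theorem IsPar.mem_escalier : ∀ {t : ℕ} {ρ : (X.iter t).P} {σ : (X.iter t).Term},
    X.IsPar t ρ σ → σ ∈ (X.iter t).escalier
  | 0, _, _, h => h.1
  | _ + 1, _, _, h => h.2.1

theorem not_isPar_head (t : ℕ) (ρ : (X.iter t).P) : ¬ X.IsPar t ρ ((X.iter t).head ρ) :=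
  fun h => head_not_mem_escalier ρ h.mem_escalier

theorem term_sub_mat_mem (t : ℕ) (v : X.Par t → A) (ρ : (X.iter t).P) :
    term A ((X.iter t).head ρ) - (X.mat t v).col ρ ∈ suppIn A {σ | X.IsPar t ρ σ} := by
  classical
  intro k η hne
  by_contra h0
  have h : ¬ X.IsPar t ρ (k, η) := h0
  rw [Pi.sub_apply, MvPolynomial.coeff_sub, coeff_term] at hne
  refine hne ?_
  change _ - (X.mat t v k ρ).coeff η = 0
  rw [coeff_mat, dif_neg h, sub_zero, sub_self]

theorem isMarkedSet_mat (t : ℕ) (v : X.Par t → A) : (X.iter t).IsMarkedSet (X.mat t v) :=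
  isMarkedSet_of_tail fun ρ => by
    refine suppIn_mono ?_ (term_sub_mat_mem t v ρ)
    exact fun σ (h : X.IsPar t ρ σ) => ⟨h.mem_escalier, X.deg_eq_of_isPar t ρ σ h⟩

theorem coeff_mat_par (t : ℕ) (v : X.Par t → A) (p : X.Par t) :
    (X.mat t v p.1.2.1 p.1.1).coeff p.1.2.2 = - v p := by
  classical
  rw [coeff_mat, if_neg, dif_pos p.2, zero_sub]
  · rfl
  · intro h
    exact not_isPar_head t p.1.1 (h ▸ p.2)

theorem mat_injective (t : ℕ) : Function.Injective (X.mat (S := A) t) := by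
  intro v w h
  funext p
  have h1 := coeff_mat_par t v p
  rw [h, coeff_mat_par] at h1
  exact (neg_injective h1).symm

theorem exists_eq_mat {t : ℕ}
    {F : Matrix (X.iter t).ι (X.iter t).P (MvPolynomial (Fin (n + 1)) A)}
    (hF : ∀ ρ, term A ((X.iter t).head ρ) - F.col ρ ∈ suppIn A {σ | X.IsPar t ρ σ}) :
    ∃ v, F = X.mat t v := by
  classical
  -- The sign is that of the convention `ρ - ∑ v_{ρ,σ} σ` for the columns.
  refine ⟨fun p => - (F p.1.2.1 p.1.1).coeff p.1.2.2, ?_⟩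
  ext k ρ η
  rw [coeff_mat]
  by_cases h : X.IsPar t ρ (k, η)
  · rw [dif_pos h, if_neg, sub_neg_eq_add, zero_add]
    intro h1
    exact not_isPar_head t ρ (h1 ▸ h)
  · rw [dif_neg h, sub_zero]
    by_contra hne
    refine h (hF ρ k η ?_)
    rw [Pi.sub_apply, MvPolynomial.coeff_sub, coeff_term, sub_ne_zero]
    exact Ne.symm hne

theorem map_mat {A' : Type*} [CommRing A'] (f : A →+* A') (t : ℕ) (v : X.Par t → A) :
    (X.mat t v).map (MvPolynomial.map f) = X.mat t fun p => f (v p) := by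
  classical
  ext k ρ η
  rw [Matrix.map_apply, MvPolynomial.coeff_map, coeff_mat, coeff_mat, map_sub, apply_ite f,
    apply_dite f, map_one, map_zero]

theorem IsMarkedSet.exists_eq_mat
    {F : Matrix (X.iter 0).ι (X.iter 0).P (MvPolynomial (Fin (n + 1)) A)}
    (hF : X.IsMarkedSet F) : ∃ v, F = X.mat 0 v := by
  refine Shape.exists_eq_mat (t := 0) fun ρ => ?_
  have h := Submodule.neg_mem _ (hF.tail_mem ρ)
  rw [neg_sub] at h
  exact h

theorem IsFundSyz.exists_eq_mat (hX : X.IsPommaret) {t : ℕ}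
    {F : Matrix (X.iter t).ι (X.iter t).P (MvPolynomial (Fin (n + 1)) A)}
    (hF : (X.iter t).IsMarkedSet F)
    {G : Matrix (X.iter (t + 1)).ι (X.iter (t + 1)).P (MvPolynomial (Fin (n + 1)) A)}
    (hG : (X.iter t).IsFundSyz F G) : ∃ v, G = X.mat (t + 1) v :=
  Shape.exists_eq_mat (t := t + 1) fun ρ => isFundSyz_supp (hX.iter t) hF hG ρ

/-- The product of `mat t v` and `mat (t + 1) w`. -/
def matProd (t : ℕ) (v : X.Par t → A) (w : X.Par (t + 1) → A) :
    Matrix (X.iter t).ι (X.iter (t + 1)).P (MvPolynomial (Fin (n + 1)) A) :=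
  let N : Matrix (X.iter t).P (X.iter (t + 1)).P (MvPolynomial (Fin (n + 1)) A) := X.mat (t + 1) w
  X.mat t v * N

theorem map_matProd {A' : Type*} [CommRing A'] (f : A →+* A') (t : ℕ) (v : X.Par t → A)
    (w : X.Par (t + 1) → A) :
    (matProd t v w).map (MvPolynomial.map f) =
      matProd t (fun p => f (v p)) (fun p => f (w p)) := by
  refine Eq.trans Matrix.map_mul ?_
  rw [map_mat]
  exact congrArg (fun N : Matrix (X.iter t).P (X.iter (t + 1)).P _ => X.mat t _ * N)
    (map_mat f (t + 1) w)

/-- The support condition of `isFundSyz_iff` is automatic, since parameters sit only on terms of the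
sous-escalier of the next shape, which is `mult`. -/
theorem isFundSyz_mat_iff (t : ℕ) (v : X.Par t → A) (w : X.Par (t + 1) → A) :
    (X.iter t).IsFundSyz (X.mat t v) (X.mat (t + 1) w) ↔ matProd t v w = 0 := by
  refine (isFundSyz_iff (X := X.iter t) (F := X.mat t v) (G := X.mat (t + 1) w)).trans ?_
  constructor
  · intro h
    ext1 k ρ
    exact congrFun (h ρ).1 k
  · intro h ρ
    refine ⟨funext fun k => congrFun (congrFun h k) ρ, ?_⟩
    rw [← next_escalier]
    exact suppIn_mono (fun σ (hσ : X.IsPar (t + 1) ρ σ) => hσ.2.1) (term_sub_mat_mem (t + 1) w ρ)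

end Shape

/-! ### Points of the functor as solutions of the equations -/

namespace Shape

variable {n : ℕ} {X : Shape n}

section Sequences

variable {A : Type*} [CommRing A]

/-- Every matrix of the sequence consists of the fundamental syzygies of the previous one. -/
def IsSeq (w : ∀ t : ℕ, X.Par t → A) : Prop := ∀ t, matProd t (w t) (w (t + 1)) = 0

/-- Solutions in `A` of the equations `M_t M_{t+1} = 0`, `t < n - D`. -/
def IsSol (v : ∀ t : Fin (X.len + 1), X.Par t → A) : Prop :=
  ∀ (t : ℕ) (ht : t < X.len),
    matProd t (v ⟨t, Nat.lt_succ_of_lt ht⟩) (v ⟨t + 1, Nat.succ_lt_succ ht⟩) = 0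

theorem exists_matProd_eq_zero (hX : X.IsPommaret) (t : ℕ) {v : X.Par t → A}
    (hv : ∃ G, (X.iter t).IsFundSyz (X.mat t v) G) :
    ∃ w : X.Par (t + 1) → A, matProd t v w = 0 ∧
      ∃ H, (X.iter (t + 1)).IsFundSyz (X.mat (t + 1) w) H := by
  obtain ⟨G, hG⟩ := hv
  have hF := isMarkedSet_mat t v
  obtain ⟨w, hw⟩ := IsFundSyz.exists_eq_mat hX hF hG
  have hG' : (X.iter t).IsFundSyz (X.mat t v) (X.mat (t + 1) w) := hw ▸ hG
  exact ⟨w, (isFundSyz_mat_iff t v w).1 hG', IsFundSyz.exists_next (hX.iter t) hF hG'⟩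

/-- The recursion carries the existence of fundamental syzygies as its invariant. The sequence is
not cut at `n - D`, so truncation is a matter of restriction only. -/
theorem exists_isSeq (hX : X.IsPommaret) {v : X.Par 0 → A}
    (hv : ∃ G, (X.iter 0).IsFundSyz (X.mat 0 v) G) :
    ∃ w : ∀ t : ℕ, X.Par t → A, w 0 = v ∧ IsSeq w := by
  choose f hf hf' using fun (t : ℕ)
    (v : {v : X.Par t → A // ∃ G, (X.iter t).IsFundSyz (X.mat t v) G}) =>
      exists_matProd_eq_zero hX t v.2
  let w : ∀ t : ℕ, {v : X.Par t → A // ∃ G, (X.iter t).IsFundSyz (X.mat t v) G} := fun t =>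
    Nat.rec ⟨v, hv⟩ (fun t v => ⟨f t v, hf' t v⟩) t
  exact ⟨fun t => (w t).1, rfl, fun t => hf t (w t)⟩

theorem IsSeq.isFundSyz {w : ∀ t : ℕ, X.Par t → A} (hw : IsSeq w) (t : ℕ) :
    (X.iter t).IsFundSyz (X.mat t (w t)) (X.mat (t + 1) (w (t + 1))) :=
  (isFundSyz_mat_iff t _ _).2 (hw t)

theorem D_le (τ : X.P) : X.D ≤ minVar (X.exp τ) := Finset.inf_le (Finset.mem_univ τ)

theorem IsSol.exists_isFundSyz {v : ∀ t : Fin (X.len + 1), X.Par t → A} (hv : IsSol v) :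
    ∃ G, (X.iter 0).IsFundSyz (X.mat 0 (v 0)) G := by
  by_cases h : 0 < X.len
  · exact ⟨_, (isFundSyz_mat_iff 0 _ _).2 (hv 0 h)⟩
  -- When `n = D` there are no equations, but every head has all its variables multiplicative, so no
  -- index `ρ` exists.
  · refine ⟨0, fun ρ => ?_⟩
    exfalso
    have h1 : X.D ≤ minVar (X.exp ρ.1) := D_le ρ.1
    have h2 := lt_of_le_of_lt h1 ρ.2.2
    have h3 := ρ.2.1.is_lt
    rw [Fin.lt_def] at h2
    unfold len at h
    omega

/-- Each equation forces the next matrix to consist of the fundamental syzygies of the current one,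
and these are unique. -/
theorem IsSol.eq_of_isSeq (hX : X.IsPommaret) {v : ∀ t : Fin (X.len + 1), X.Par t → A}
    (hv : IsSol v) {w : ∀ t : ℕ, X.Par t → A} (hw : IsSeq w) (h : v 0 = w 0) :
    ∀ (t : ℕ) (ht : t < X.len + 1), v ⟨t, ht⟩ = w t
  | 0, _ => h
  | t + 1, ht => by
    have ih := IsSol.eq_of_isSeq hX hv hw h t (Nat.lt_of_succ_lt ht)
    have h1 := (isFundSyz_mat_iff t _ _).2 (hv t (Nat.lt_of_succ_lt_succ ht))
    rw [ih] at h1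
    exact mat_injective (t + 1)
      (isFundSyz_unique (hX.iter t) (isMarkedSet_mat t (w t)) h1 (hw.isFundSyz t))

theorem IsSol.exists_isSeq (hX : X.IsPommaret) {v : ∀ t : Fin (X.len + 1), X.Par t → A}
    (hv : IsSol v) : ∃ w : ∀ t : ℕ, X.Par t → A, IsSeq w ∧ ∀ t : Fin (X.len + 1), v t = w t := by
  obtain ⟨w, h0, hw⟩ := Shape.exists_isSeq hX hv.exists_isFundSyz
  exact ⟨w, hw, fun t => hv.eq_of_isSeq hX hw h0.symm t t.2⟩

theorem IsSol.ext (hX : X.IsPommaret) {v v' : ∀ t : Fin (X.len + 1), X.Par t → A}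
    (hv : IsSol v) (hv' : IsSol v') (h : v 0 = v' 0) : v = v' := by
  obtain ⟨w, hw, hvw⟩ := hv.exists_isSeq hX
  funext t
  rw [hvw t]
  exact (hv'.eq_of_isSeq hX hw (h ▸ hvw 0) t t.2).symm

theorem IsSol.ext_colSpan (hX : X.IsPommaret) {v v' : ∀ t : Fin (X.len + 1), X.Par t → A}
    (hv : IsSol v) (hv' : IsSol v')
    (h : (X.iter 0).colSpan (X.mat 0 (v 0)) = (X.iter 0).colSpan (X.mat 0 (v' 0))) : v = v' := by
  obtain ⟨G, hG⟩ := hv.exists_isFundSyz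
  exact hv.ext hX hv' (mat_injective 0
    (eq_of_colSpan_eq hX (isMarkedSet_mat 0 (v 0)) (isMarkedSet_mat 0 (v' 0)) hG h))

theorem IsSol.isRes (hX : X.IsPommaret) {v : ∀ t : Fin (X.len + 1), X.Par t → A}
    (hv : IsSol v) : X.IsRes fun t => (X.iter t).colSpan (X.mat t (v t)) := by
  obtain ⟨w, hw, hvw⟩ := hv.exists_isSeq hX
  have hF := isMarkedSet_mat 0 (v 0)
  obtain ⟨G, hG⟩ := hv.exists_isFundSyz
  refine ⟨isMarkedModule_of_isFundSyz hX hF hG, fun t => X.mat t (w t), ?_, ?_, ?_⟩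
  · have h : (X.iter 0).IsMarkedBasis (X.mat 0 (w 0)) :=
      isMarkedBasis_of_isFundSyz hX (isMarkedSet_mat 0 (w 0)) (hw.isFundSyz 0)
    exact h
  · exact congrArg (fun u => (X.iter 0).colSpan (X.mat 0 u)) (hvw 0).symm
  · intro t ht
    refine ⟨hw.isFundSyz t, ?_⟩
    change (X.iter (t + 1)).colSpan (X.mat (t + 1) (v ⟨t + 1, Nat.succ_lt_succ ht⟩)) = _
    rw [show v ⟨t + 1, Nat.succ_lt_succ ht⟩ = w (t + 1) from hvw ⟨t + 1, Nat.succ_lt_succ ht⟩]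
    exact IsFundSyz.colSpan_eq_syz (hX.iter t) (isMarkedSet_mat t (w t)) (hw.isFundSyz t)

/-- The marked basis has the form `mat 0 v`, and each later matrix is forced by uniqueness of
fundamental syzygies. Their column spans are the prescribed syzygy modules. -/
theorem IsRes.exists_isSol (hX : X.IsPommaret) {S : X.Tuple A} (hS : X.IsRes S) :
    ∃ v : ∀ t : Fin (X.len + 1), X.Par t → A, IsSol v ∧
      ∀ t, S t = (X.iter t).colSpan (X.mat t (v t)) := by
  obtain ⟨-, F, hF, h0, hsyz⟩ := hS
  obtain ⟨v, hv⟩ := IsMarkedSet.exists_eq_mat hF.toIsMarkedSet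
  obtain ⟨w, hw0, hw⟩ := exists_isSeq hX (hv ▸ IsMarkedBasis.exists_isFundSyz hX hF)
  have key : ∀ t : ℕ, t < X.len + 1 → F t = X.mat t (w t) := by
    intro t
    induction t with
    | zero => exact fun _ => hw0 ▸ hv
    | succ t ih =>
      intro ht
      have h1 := (hsyz t (Nat.lt_of_succ_lt_succ ht)).1
      rw [ih (Nat.lt_of_succ_lt ht)] at h1
      exact isFundSyz_unique (hX.iter t) (isMarkedSet_mat t (w t)) h1 (hw.isFundSyz t)
  refine ⟨fun t => w t, fun t _ => hw t, ?_⟩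
  rintro ⟨t, ht⟩
  cases t with
  | zero =>
    have h1 := h0.symm
    rw [key 0 ht] at h1
    exact h1
  | succ t =>
    have h1 := (hsyz t (Nat.lt_of_succ_lt_succ ht)).2
    rw [key t (Nat.lt_of_succ_lt ht)] at h1
    exact h1.trans
      (IsFundSyz.colSpan_eq_syz (hX.iter t) (isMarkedSet_mat t (w t)) (hw.isFundSyz t)).symm

theorem extend_colSpan {A' : Type*} [CommRing A'] (f : A →+* A') (Y : Shape n)
    (F : Matrix Y.ι Y.P (MvPolynomial (Fin (n + 1)) A)) :
    extend f (Y.colSpan F) = Y.colSpan (F.map (MvPolynomial.map f)) := by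
  apply le_antisymm
  · refine Submodule.span_le.2 ?_
    rintro _ ⟨_, hw, rfl⟩
    obtain ⟨Q, rfl⟩ := mem_colSpan_iff.1 hw
    exact mem_colSpan_iff.2 ⟨_, (mapVec_mulVec f F Q).symm⟩
  · refine Submodule.span_le.2 ?_
    rintro _ ⟨τ, rfl⟩
    exact Submodule.subset_span ⟨F.col τ, Submodule.subset_span ⟨τ, rfl⟩, rfl⟩

theorem IsSol.map {A' : Type*} [CommRing A'] (f : A →+* A')
    {v : ∀ t : Fin (X.len + 1), X.Par t → A} (hv : IsSol v) :
    IsSol fun t p => f (v t p) := by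
  intro t ht
  rw [← map_matProd, hv t ht]
  ext
  simp

/-- Flatness plays no role: the modules are column spans of matrices, and the equations between
those matrices persist under any ring homomorphism. -/
theorem IsRes.extend (hX : X.IsPommaret) {A' : Type*} [CommRing A'] (f : A →+* A')
    {S : X.Tuple A} (hS : X.IsRes S) : X.IsRes fun t => Shape.extend f (S t) := by
  obtain ⟨v, hv, hSv⟩ := hS.exists_isSol hX
  have h := (hv.map f).isRes hX
  convert! h using 2 with t
  rw [hSv t, extend_colSpan, map_mat]

/-! ### Normal forms under base change -/

theorem IsNormalForm.map {A' : Type*} [CommRing A'] (f : A →+* A')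
    {F : Matrix X.ι X.P (MvPolynomial (Fin (n + 1)) A)} {h g : X.Free A}
    (hg : X.IsNormalForm F h g) :
    X.IsNormalForm (F.map (MvPolynomial.map f)) (mapVec f h) (mapVec f g) := by
  obtain ⟨h1, Q, h2, h3⟩ := hg
  rw [escSpan_eq] at h1
  refine ⟨?_, mapVec f Q, X.coneSupported_iff.2 (mapVec_mem_suppIn f (X.coneSupported_iff.1 h2)), ?_⟩
  · rw [escSpan_eq]
    exact mapVec_mem_suppIn f h1
  · rw [h3, mapVec_add, mapVec_mulVec]

theorem mapVec_X_smul_col {A' : Type*} [CommRing A'] (f : A →+* A')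
    (F : Matrix X.ι X.P (MvPolynomial (Fin (n + 1)) A)) (i : Fin (n + 1)) (τ : X.P) :
    mapVec f ((MvPolynomial.X i : MvPolynomial (Fin (n + 1)) A) • F.col τ) =
      (MvPolynomial.X i : MvPolynomial (Fin (n + 1)) A') •
        (F.map (MvPolynomial.map f)).col τ := by
  rw [mapVec_smul, MvPolynomial.map_X]
  rfl

theorem exists_isNormalForm (hX : X.IsPommaret)
    {F : Matrix X.ι X.P (MvPolynomial (Fin (n + 1)) A)} (hF : X.IsMarkedSet F) {τ : X.P}
    {i : Fin (n + 1)} (hi : minVar (X.exp τ) < i) :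
    ∃ g, X.IsNormalForm F ((MvPolynomial.X i : MvPolynomial (Fin (n + 1)) A) • F.col τ) g := by
  obtain ⟨Q, hQ, g, hg, h1⟩ := mem_reducible.1 (X_smul_col_mem_reducible hX hF hi)
  refine ⟨g, ?_, Q, X.coneSupported_iff.2 (suppIn_mono (fun _ h => h.1) hQ), h1.symm⟩
  rw [escSpan_eq]
  exact suppIn_mono (fun _ h => h.1) hg

theorem IsFundSyz.normalForm_eq (hX : X.IsPommaret)
    {F : Matrix X.ι X.P (MvPolynomial (Fin (n + 1)) A)} (hF : X.IsMarkedSet F)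
    {G : Matrix X.next.ι X.next.P (MvPolynomial (Fin (n + 1)) A)} (hG : X.IsFundSyz F G)
    (ρ : X.next.P) {Q : X.P → MvPolynomial (Fin (n + 1)) A} {g : X.Free A}
    (hQ : X.ConeSupported Q) (hg : g ∈ X.escSpan A)
    (h : (MvPolynomial.X ρ.2.1 : MvPolynomial (Fin (n + 1)) A) • F.col ρ.1 = F.mulVec Q + g) :
    g = 0 ∧ ∀ γ : X.P, G γ ρ = term A (X.next.head ρ) γ - Q γ := by
  obtain ⟨Q', hQ', h1, h2⟩ := hG ρ
  rw [escSpan_eq] at hg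
  rw [h1, ← add_zero (F.mulVec Q')] at h
  obtain ⟨h3, h4⟩ := normalForm_unique hX hF (X.coneSupported_iff.1 hQ')
    (X.coneSupported_iff.1 hQ) (Submodule.zero_mem _) hg h
  exact ⟨h4.symm, h3 ▸ h2⟩

end Sequences

end Shape

/-! ### The representing algebra -/

namespace Shape

variable {n : ℕ} {X : Shape n} {K : Type u} [Field K]

section Rings

variable {A : Type*} [CommRing A]

theorem idealS_le_ker_iff (ψ : X.TotRing K →+* A) (t : ℕ) (ht : t < X.len) :
    X.idealS K t ht ≤ RingHom.ker ψ ↔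
      matProd t (fun p => ψ (MvPolynomial.X ⟨⟨t, Nat.lt_succ_of_lt ht⟩, p⟩))
        (fun p => ψ (MvPolynomial.X ⟨⟨t + 1, Nat.succ_lt_succ ht⟩, p⟩)) = 0 := by
  have h : (X.prodM K t ht).map (MvPolynomial.map ψ) =
      matProd t (fun p => ψ (MvPolynomial.X ⟨⟨t, Nat.lt_succ_of_lt ht⟩, p⟩))
        (fun p => ψ (MvPolynomial.X ⟨⟨t + 1, Nat.succ_lt_succ ht⟩, p⟩)) :=
    map_matProd ψ t _ _
  rw [← h, idealS, Ideal.span_le]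
  constructor
  · intro h1
    ext k ρ η
    rw [Matrix.map_apply, MvPolynomial.coeff_map]
    exact h1 ⟨k, ρ, η, rfl⟩
  · rintro h1 _ ⟨k, ρ, η, rfl⟩
    have h2 := congrArg (MvPolynomial.coeff η) (congrFun (congrFun h1 k) ρ)
    rw [Matrix.map_apply, MvPolynomial.coeff_map] at h2
    exact h2

theorem idealSum_le_ker_iff (ψ : X.TotRing K →+* A) :
    X.idealSum K ≤ RingHom.ker ψ ↔ IsSol fun t p => ψ (MvPolynomial.X ⟨t, p⟩) := by
  rw [idealSum, iSup_le_iff]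
  exact ⟨fun h t ht => (idealS_le_ker_iff ψ t ht).1 (h ⟨t, ht⟩),
    fun h t => (idealS_le_ker_iff ψ t t.2).2 (h t t.2)⟩

theorem isSol_mk : IsSol fun t (p : X.Par t) =>
    Ideal.Quotient.mk (X.idealSum K) (MvPolynomial.X ⟨t, p⟩) :=
  (idealSum_le_ker_iff _).1 Ideal.mk_ker.ge

theorem IsSol.exists_algHom [Algebra K A] {v : ∀ t : Fin (X.len + 1), X.Par t → A}
    (hv : IsSol v) : ∃ φ : X.ResAlg K →ₐ[K] A, ∀ (t : Fin (X.len + 1)) (p : X.Par t),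
      φ (Ideal.Quotient.mk (X.idealSum K) (MvPolynomial.X ⟨t, p⟩)) = v t p := by
  let ψ : X.TotRing K →ₐ[K] A := MvPolynomial.aeval fun q : X.Tot => v q.1 q.2
  have hψ : ∀ (t : Fin (X.len + 1)) (p : X.Par t), ψ (MvPolynomial.X ⟨t, p⟩) = v t p :=
    fun t p => MvPolynomial.aeval_X _ _
  have h : X.idealSum K ≤ RingHom.ker (ψ : X.TotRing K →+* A) := by
    rw [idealSum_le_ker_iff]
    have h1 : (fun (t : Fin (X.len + 1)) (p : X.Par t) =>
        (ψ : X.TotRing K →+* A) (MvPolynomial.X ⟨t, p⟩)) = v := by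
      funext t p
      exact hψ t p
    rw [h1]
    exact hv
  exact ⟨Ideal.Quotient.liftₐ _ ψ fun a ha => h ha, fun t p => hψ t p⟩

theorem resAlg_hom_ext {φ φ' : X.ResAlg K →+* A}
    (hK : ∀ a : K, φ (algebraMap K _ a) = φ' (algebraMap K _ a))
    (h : ∀ (t : Fin (X.len + 1)) (p : X.Par t),
      φ (Ideal.Quotient.mk (X.idealSum K) (MvPolynomial.X ⟨t, p⟩)) =
        φ' (Ideal.Quotient.mk (X.idealSum K) (MvPolynomial.X ⟨t, p⟩))) : φ = φ' := by
  apply Ideal.Quotient.ringHom_ext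
  apply MvPolynomial.ringHom_ext
  · exact hK
  · rintro ⟨t, p⟩
    exact h t p

end Rings

theorem resStable (hX : X.IsPommaret) : X.ResStable K := fun A A' f _ hS =>
  hS.extend hX (f.hom.hom : A.obj →+* A'.obj)

section Tuples

variable {A : Type*} [CommRing A] [Algebra K A]

/-- The tuple of modules corresponding to a homomorphism. -/
def resOfAlgHom (hX : X.IsPommaret) (φ : X.ResAlg K →ₐ[K] A) : {S : X.Tuple A // X.IsRes S} :=
  ⟨fun t => (X.iter t).colSpan (X.mat t fun p =>
    φ (Ideal.Quotient.mk (X.idealSum K) (MvPolynomial.X ⟨t, p⟩))),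
    (isSol_mk.map (φ : X.ResAlg K →+* A)).isRes hX⟩

theorem resOfAlgHom_bijective (hX : X.IsPommaret) :
    Function.Bijective (resOfAlgHom (A := A) (K := K) hX) := by
  constructor
  · intro φ φ' h
    -- The component at `0`, the module `M` itself, already determines all parameters.
    have h1 := IsSol.ext_colSpan hX (isSol_mk.map (φ : X.ResAlg K →+* A))
      (isSol_mk.map (φ' : X.ResAlg K →+* A)) (congrFun (congrArg Subtype.val h) 0)
    have h2 : (φ : X.ResAlg K →+* A) = (φ' : X.ResAlg K →+* A) :=
      resAlg_hom_ext (fun a => (φ.commutes a).trans (φ'.commutes a).symm)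
        fun t p => congrFun (congrFun h1 t) p
    exact AlgHom.ext fun x => RingHom.congr_fun h2 x
  · rintro ⟨S, hS⟩
    obtain ⟨v, hv, hSv⟩ := hS.exists_isSol hX
    obtain ⟨φ, hφ⟩ := hv.exists_algHom (K := K)
    refine ⟨φ, Subtype.ext (funext fun t => ?_)⟩
    exact (congrArg (fun u => (X.iter t).colSpan (X.mat t u))
      (funext fun p => hφ t p)).trans (hSv t).symm

end Tuples

/-- Morphisms from `resObj` as algebra homomorphisms. -/
def resHomEquiv (A : NoethAlg K) : (X.resObj K ⟶ A) ≃ (X.ResAlg K →ₐ[K] A.obj) where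
  toFun φ := φ.hom.hom
  invFun φ := ObjectProperty.homMk (CommAlgCat.ofHom φ)
  left_inv _ := rfl
  right_inv _ := rfl

/-- The marked resolution functor is represented by `ResAlg`. -/
def corepresentableBy (hX : X.IsPommaret) :
    (X.resFunctor K (resStable hX)).CorepresentableBy (X.resObj K) where
  homEquiv {A} := (resHomEquiv A).trans
    (Equiv.ofBijective (resOfAlgHom hX) (resOfAlgHom_bijective hX))
  homEquiv_comp {A A'} g f := by
    apply Subtype.ext
    funext t
    refine Eq.symm ((extend_colSpan (g.hom.hom : A.obj →+* A'.obj) (X.iter t) _).trans ?_)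
    rw [map_mat]
    rfl

/-! ### Elimination of parameters and comparison with `K[C]/𝒰` -/

/-- Modulo `𝒮^(t+1)`, the parameters of `B^(t+1)` are polynomials in those of `B^(t)`. -/
theorem exists_sub_mem_idealS (hX : X.IsPommaret) (t : ℕ) (ht : t < X.len) (p : X.Par (t + 1)) :
    ∃ q : MvPolynomial (X.Par t) K,
      (MvPolynomial.X ⟨⟨t + 1, Nat.succ_lt_succ ht⟩, p⟩ : X.TotRing K) -
        X.incl K ⟨t, Nat.lt_succ_of_lt ht⟩ q ∈ X.idealS K t ht := by
  obtain ⟨⟨ρ, ⟨γ, η⟩⟩, hp⟩ := p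
  let F : Matrix (X.iter t).ι (X.iter t).P
      (MvPolynomial (Fin (n + 1)) (MvPolynomial (X.Par t) K)) := X.mat t MvPolynomial.X
  let π := Ideal.Quotient.mk (X.idealS K t ht)
  let f : MvPolynomial (X.Par t) K →+* X.TotRing K ⧸ X.idealS K t ht :=
    π.comp (X.incl K ⟨t, Nat.lt_succ_of_lt ht⟩).toRingHom
  -- Divide over `K[B^(t)]`, where `g` need not vanish. Modulo `𝒮^(t+1)` fundamental syzygies exist,
  -- so the image of `g` is zero and the image of `Q` gives the entries of `M_{t+1}`.
  obtain ⟨g, hg⟩ := exists_isNormalForm (hX.iter t) (F := F) (isMarkedSet_mat t _) ρ.2.2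
  obtain ⟨h1, Q, hQ, h2⟩ := hg
  have hF : F.map (MvPolynomial.map f) = X.mat t fun p =>
      π (MvPolynomial.X ⟨⟨t, Nat.lt_succ_of_lt ht⟩, p⟩) := by
    rw [map_mat]
    congr 1
    funext p
    simp [f, incl]
  have hG := (isFundSyz_mat_iff t _ _).2 ((idealS_le_ker_iff π t ht).1 Ideal.mk_ker.ge)
  rw [← hF] at hG
  have h3 := congrArg (mapVec f) h2
  rw [mapVec_X_smul_col, mapVec_add, mapVec_mulVec] at h3
  rw [escSpan_eq] at h1
  have h4 := (hG.normalForm_eq (hX.iter t) (hF ▸ isMarkedSet_mat t _) ρ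
    (coneSupported_iff _ |>.2 (mapVec_mem_suppIn f (coneSupported_iff _ |>.1 hQ)))
    (by rw [escSpan_eq]; exact mapVec_mem_suppIn f h1) h3).2 γ
  -- Both the parameter and the cofactor enter the column with a minus sign, so the two signs
  -- cancel.
  refine ⟨(Q γ).coeff η, ?_⟩
  rw [← Ideal.Quotient.eq]
  have h5 := congrArg (MvPolynomial.coeff η) h4
  have h6 := coeff_mat_par (t + 1)
    (fun p => π (MvPolynomial.X ⟨⟨t + 1, Nat.succ_lt_succ ht⟩, p⟩)) ⟨(ρ, (γ, η)), hp⟩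
  classical
  have h7 : (term (X.TotRing K ⧸ X.idealS K t ht) ((X.iter t).next.head ρ) γ).coeff η = 0 :=
    (coeff_term _ _ _).trans (if_neg fun h => by
      refine not_isPar_head (t + 1) ρ ?_
      rw [show (X.iter (t + 1)).head ρ = (γ, η) from h.symm]
      exact hp)
  rw [MvPolynomial.coeff_sub, h7, zero_sub] at h5
  have h8 := neg_injective (h6.symm.trans h5)
  refine h8.trans ?_
  exact MvPolynomial.coeff_map f _ _

/-- The coefficients of the generic normal forms generate `𝒰`, so over `K[C]/𝒰` every `x_i F_τ` has
a writing without remainder. -/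
theorem exists_isFundSyz_mfAlg (hX : X.IsPommaret) :
    ∃ G, (X.iter 0).IsFundSyz (X.mat 0 fun p =>
      Ideal.Quotient.mk (X.idealU K) (MvPolynomial.X p)) G := by
  set f := Ideal.Quotient.mk (X.idealU K) with hf
  have hF : (X.genericMat K).map (MvPolynomial.map f) =
      X.mat 0 fun p => f (MvPolynomial.X p) := map_mat f 0 _
  rw [← hF]
  refine isFundSyz_of_forall_mem (X := X) (W := {h | ∃ Q ∈ suppIn (X.MfAlg K) X.mult,
    ((X.genericMat K).map (MvPolynomial.map f)).mulVec Q = h}) (fun _ h => h) fun τ i hi => ?_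
  obtain ⟨g, hg⟩ := exists_isNormalForm hX (F := X.genericMat K) (isMarkedSet_mat 0 _) hi
  obtain ⟨-, Q, hQ, h2⟩ := hg.map f
  have h3 : mapVec f g = 0 := by
    funext k
    ext η
    have hmem : (g k).coeff η ∈ X.idealU K :=
      Ideal.subset_span ⟨τ, i, g, (k, η), hi, hg, rfl⟩
    refine (MvPolynomial.coeff_map f _ _).trans ?_
    rw [hf, Ideal.Quotient.eq_zero_iff_mem.2 hmem]
    simp
  rw [h3, add_zero, mapVec_X_smul_col] at h2
  exact ⟨Q, X.coneSupported_iff.1 hQ, h2.symm⟩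

/-- Extending the generic marked set over `K[C]/𝒰` to a sequence of fundamental syzygies solves all
the equations. This is the candidate inverse of the map induced by `K[C] ⊆ K[C,B]`. -/
theorem exists_algHom_mfAlg (hX : X.IsPommaret) :
    ∃ ψ : X.ResAlg K →ₐ[K] X.MfAlg K, ∀ p : X.Par 0,
      ψ (Ideal.Quotient.mk (X.idealSum K) (MvPolynomial.X ⟨0, p⟩)) =
        Ideal.Quotient.mk (X.idealU K) (MvPolynomial.X p) := by
  obtain ⟨w, h0, hw⟩ := exists_isSeq hX (exists_isFundSyz_mfAlg (K := K) hX)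
  have hv : IsSol fun t : Fin (X.len + 1) => w t := fun t _ => hw t
  obtain ⟨ψ, hψ⟩ := hv.exists_algHom (K := K)
  exact ⟨ψ, fun p => (hψ 0 p).trans (congrFun h0 p)⟩

/-- Over the quotient by `idealSum` the `x_i F_τ` have writings with zero remainder. The images of
the generic normal forms are normal forms there, so they vanish by uniqueness. -/
theorem idealU_le_comap (hX : X.IsPommaret) :
    X.idealU K ≤ (X.idealSum K).comap (X.incl K 0).toRingHom := by
  refine Ideal.span_le.2 ?_
  rintro _ ⟨τ, i, g, σ, hi, hg, rfl⟩
  let f : MvPolynomial (X.Par 0) K →+* X.ResAlg K :=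
    (Ideal.Quotient.mk (X.idealSum K)).comp (X.incl K 0).toRingHom
  have hF : (X.genericMat K).map (MvPolynomial.map f) = X.mat 0 fun p =>
      Ideal.Quotient.mk (X.idealSum K) (MvPolynomial.X ⟨0, p⟩) := by
    refine (map_mat f 0 _).trans ?_
    congr 1
    funext p
    simp [f, incl]
  obtain ⟨G, hG⟩ := (isSol_mk (X := X) (K := K)).exists_isFundSyz
  obtain ⟨h1, Q, hQ, h2⟩ := hg.map f
  rw [mapVec_X_smul_col, hF] at h2
  have h3 := (IsFundSyz.normalForm_eq (X := X) hX (isMarkedSet_mat 0 _) hG ⟨τ, i, hi⟩ hQ h1 h2).1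
  have h4 := congrArg (MvPolynomial.coeff σ.2) (congrFun h3 σ.1)
  have h5 : f ((g σ.1).coeff σ.2) = 0 := (MvPolynomial.coeff_map f _ _).symm.trans h4
  exact (Ideal.Quotient.eq_zero_iff_mem (I := X.idealSum K)).1 h5

theorem idealU_eq_comap (hX : X.IsPommaret) :
    X.idealU K = (X.idealSum K).comap (X.incl K 0).toRingHom := by
  refine le_antisymm (idealU_le_comap hX) fun q hq => ?_
  obtain ⟨ψ, hψ⟩ := exists_algHom_mfAlg (K := K) hX
  -- The composite `K[C] → K[C,B] → ResAlg → MfAlg` is the quotient map, so whatever dies in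
  -- `ResAlg` lies in `𝒰`.
  have h : ((ψ : X.ResAlg K →+* X.MfAlg K).comp (Ideal.Quotient.mk (X.idealSum K))).comp
      (X.incl K 0).toRingHom = Ideal.Quotient.mk (X.idealU K) := by
    apply MvPolynomial.ringHom_ext
    · intro a
      have h1 : (X.incl K 0).toRingHom (MvPolynomial.C a) = MvPolynomial.C a :=
        (X.incl K 0).commutes a
      rw [RingHom.comp_apply, h1]
      exact ψ.commutes a
    · intro p
      have h1 : (X.incl K 0).toRingHom (MvPolynomial.X p) = MvPolynomial.X ⟨0, p⟩ :=
        MvPolynomial.rename_X _ _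
      rw [RingHom.comp_apply, h1]
      exact hψ p
  rw [← Ideal.Quotient.eq_zero_iff_mem, ← h]
  exact (congrArg ψ (Ideal.Quotient.eq_zero_iff_mem.2 (Ideal.mem_comap.1 hq))).trans (map_zero ψ)

theorem quotientMap_bijective (hX : X.IsPommaret)
    (hU : X.idealU K ≤ (X.idealSum K).comap (X.incl K 0).toRingHom) :
    Function.Bijective
      (Ideal.quotientMap (I := X.idealU K) (X.idealSum K) (X.incl K 0).toRingHom hU) := by
  constructor
  · exact Ideal.quotientMap_injective' (idealU_eq_comap hX).ge
  · obtain ⟨ψ, hψ⟩ := exists_algHom_mfAlg (K := K) hX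
    set j := Ideal.quotientMap (I := X.idealU K) (X.idealSum K) (X.incl K 0).toRingHom hU with hj
    have hjX : ∀ p, j (Ideal.Quotient.mk (X.idealU K) (MvPolynomial.X p)) =
        Ideal.Quotient.mk (X.idealSum K) (MvPolynomial.X ⟨0, p⟩) := fun p =>
      congrArg (Ideal.Quotient.mk (X.idealSum K)) (MvPolynomial.rename_X _ _)
    have hjK : ∀ a, j (algebraMap K _ a) = algebraMap K _ a := fun a =>
      congrArg (Ideal.Quotient.mk (X.idealSum K)) ((X.incl K 0).commutes a)
    -- Surjectivity: the generic solution and its image under `j ∘ ψ` are solutions with the same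
    -- values on `C`, hence equal, so `j ∘ ψ` is the identity.
    have h1 := IsSol.ext hX ((isSol_mk (X := X) (K := K)).map
      (j.comp (ψ : X.ResAlg K →+* X.MfAlg K))) (isSol_mk (X := X) (K := K)) (by
        funext p
        exact (congrArg j (hψ p)).trans (hjX p))
    have h2 : j.comp (ψ : X.ResAlg K →+* X.MfAlg K) = RingHom.id _ :=
      resAlg_hom_ext (fun a => (congrArg j (ψ.commutes a)).trans (hjK a))
        fun t p => congrFun (congrFun h1 t) p
    exact fun x => ⟨ψ x, RingHom.congr_fun h2 x⟩

end Shape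

/-! ### From a Pommaret basis of `U` to the combinatorial condition, and the theorem -/

theorem IsPommaretBasis.isPommaret {n m : ℕ} {K : Type u} [Field K]
    {U : Submodule (MvPolynomial (Fin (n + 1)) K) (Fin m → MvPolynomial (Fin (n + 1)) K)}
    {T : Finset (Fin m × Mon n)} (hT : IsPommaretBasis U T) (d : Fin m → ℤ) :
    (Shape.ofFinset d T).IsPommaret := by
  constructor
  · intro σ hσ
    rw [Shape.mem_escalier_iff (A := K), not_not] at hσ
    have h1 : Submodule.span (MvPolynomial (Fin (n + 1)) K)
        (Set.range fun τ : (Shape.ofFinset d T).P => term K ((Shape.ofFinset d T).head τ)) ≤ U := by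
      rw [← hT.span_eq]
      refine Submodule.span_mono ?_
      rintro _ ⟨τ, rfl⟩
      exact ⟨τ.1, τ.2, rfl⟩
    obtain ⟨τ, hτ, hc⟩ := (hT.mem_iff σ).1 (h1 hσ)
    exact ⟨⟨τ, hτ⟩, hc⟩
  · intro τ τ' σ h h'
    exact Subtype.ext (hT.disjoint τ.1 τ.2 τ'.1 τ'.2 σ h h')

end

end MarkedRes

theorem mainTheorem9 {K : Type u} [Field K] (n m : ℕ) (d : Fin m → ℤ)
    (U : Submodule (MvPolynomial (Fin (n + 1)) K) (Fin m → MvPolynomial (Fin (n + 1)) K))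
    (T : Finset (Fin m × MarkedRes.Mon n)) (hT : MarkedRes.IsPommaretBasis U T)
    (X : MarkedRes.Shape n) (hX : X = MarkedRes.Shape.ofFinset d T) :
    -- the marked resolution functor is well defined and represented by `K[C,B]/∑ 𝒮^(t)`:
    -- a homomorphism `φ` corresponds to the modules generated by the columns of the `φ(M_t)`
    (∃ (h : X.ResStable K) (e : (X.resFunctor K h).CorepresentableBy (X.resObj K)),
      ∀ (A : MarkedRes.NoethAlg K) (φ : X.resObj K ⟶ A) (t : Fin (X.len + 1)),
        (e.homEquiv φ).1 t = (X.iter t).colSpan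
          (X.mat t fun p => φ.hom.hom
            (Ideal.Quotient.mk (X.idealSum K) (MvPolynomial.X ⟨t, p⟩)))) ∧
    -- recursive elimination: modulo `𝒮^(t+1)` every parameter of `B^(t+1)` equals a polynomial in
    -- the parameters of `B^(t)` (of `C`, if `t = 0`)
    (∀ (t : ℕ) (ht : t < X.len) (p : X.Par (t + 1)), ∃ q : MvPolynomial (X.Par t) K,
      (MvPolynomial.X ⟨⟨t + 1, Nat.succ_lt_succ ht⟩, p⟩ : X.TotRing K) -
        X.incl K ⟨t, Nat.lt_succ_of_lt ht⟩ q ∈ X.idealS K t ht) ∧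
    -- `𝒰 = (∑ 𝒮^(t)) ∩ K[C]`, and the projection is an isomorphism of schemes
    (∃ hU : X.idealU K = (X.idealSum K).comap (X.incl K 0).toRingHom,
      IsIso (AlgebraicGeometry.Spec.map (CommRingCat.ofHom
        (Ideal.quotientMap (I := X.idealU K) (X.idealSum K) (X.incl K 0).toRingHom hU.le)))) := by
  subst hX
  have hX := hT.isPommaret d
  refine ⟨⟨MarkedRes.Shape.resStable hX, MarkedRes.Shape.corepresentableBy hX, fun A φ t => rfl⟩,
    MarkedRes.Shape.exists_sub_mem_idealS hX, MarkedRes.Shape.idealU_eq_comap hX, ?_⟩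
  have := (ConcreteCategory.isIso_iff_bijective (CommRingCat.ofHom (Ideal.quotientMap _ _
    (MarkedRes.Shape.idealU_eq_comap (K := K) hX).le))).2
      (MarkedRes.Shape.quotientMap_bijective hX (MarkedRes.Shape.idealU_eq_comap hX).le)
  infer_instance
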